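/- Let $P$ be a finite projective geometry of dimension $n\ge 2$ (points and lines, two distinct points on a unique line, the Veblen–Young axiom, at least three points on every line), and let $\Pi$ be the set of its subspaces other than the empty one and the whole space $V$, ordered by inclusion. For $x\in\Pi$ let $\dim x\in\{1,\dots,n\}$ be its linear dimension (points have dimension $1$), and call $x,y\in\Pi$ incident if $x\subseteq y$ or $y\subseteq x$. Let $\lambda:\Pi\to\Pi$ be an involution with $\dim\lambda(x)=n+1-\dim x$ for all $x$, and let $\mathcal T\subseteq\Pi^3$ be an $\widetilde A_n$-triangle presentation compatible with $\lambda$; that is, with $\mathcal T'=\{(u,v,w)\in\mathcal T:\dim u+\dim v+\dim w=n+1\}$: (A) for $u,v\in\Pi$, there is a $w$ with $(u,v,w)\in\mathcal T$ if and only if $\lambda(u)$ and $v$ are distinct and incident; (B) $(u,v,w)\in\mathcal T$ implies $(v,w,u)\in\mathcal T$; (C) $(u,v,w_1),(u,v,w_2)\in\mathcal T$ implies $w_1=w_2$; (D) $(u,v,w)\in\mathcal T$ implies $(\lambda(w),\lambda(v),\lambda(u))\in\mathcal T$; (E) $(u,v,w)\in\mathcal T$ implies $\dim u+\dim v+\dim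 w\in\{n+1,2(n+1)\}$; (F) if $(x,y,u)\in\mathcal T'$ and $(x',y',\lambda(u))\in\mathcal T'$, then for some $w\in\Pi$ both $(y',x,w)\in\mathcal T'$ and $(y,x',\lambda(w))\in\mathcal T'$. Let $\Gamma_{\mathcal T}=\langle \{a_v\}_{v\in\Pi}\mid a_{\lambda(v)}=a_v^{-1}\ (v\in\Pi),\ a_ua_va_w=1\ ((u,v,w)\in\mathcal T)\rangle$ be the associated (finitely generated) $\widetilde A_n$-group. Let $|g|$ be the word length with respect to the generators $a_v$ and $d(g,h)=|g^{-1}h|$. Let $L$ be the set of words $u_1\cdots u_\ell$ over $\Pi$ such that, for $1\le i<\ell$, no element of $\Pi$ contains both $\lambda(u_i)$ and $u_{i+1}$. For a word $u=u_1\cdots u_\ell$ put $\bar u=a_{u_1}\cdots a_{u_\ell}$, $u(t)=a_{u_1}\cdots a_{u_t}$ for $0\le t\le\ell$ and $u(t)=\bar u$ for $t>\ell$. Then: 1. Every $g\in\Gamma_{\mathcal T}$ equals $\bar v$ for exactly one $v\in L$, the normal form of $g$. 2. If $u\in L$, $x\in\Pi$ and $v\in L$ is the normal form of $\bar u a_x$,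 then $d(u(t),v(t))\le 1$ for all integers $t\ge0$; that is, either $u(t)=v(t)$, or $u(t)=v(t)a_{y}$ for some $y\in\Pi$ (depending on $t$). 3. $L$ is a regular language, it is geodesic ($|\bar u|=\ell$ for $u=u_1\cdots u_\ell\in L$), and it is symmetric ($u_1\cdots u_\ell\in L$ implies $\lambda(u_\ell)\cdots\lambda(u_1)\in L$). 4. $L$ is the language of an automatic structure on $\Gamma_{\mathcal T}$ over the alphabet $\Pi$: $L$ is regular and maps onto $\Gamma_{\mathcal T}$, and the sets of padded pairs $(w_1,w_2)\in L^2$ with $\bar w_1=\bar w_2$, and with $\bar w_1a_x=\bar w_2$ for each fixed $x\in\Pi$, are regular. It is also biautomatic: the sets of padded pairs $(w_1,w_2)\in L^2$ with $a_x\bar w_1=\bar w_2$ are regular as well. In particular $\Gamma_{\mathcal T}$ is an automatic group, and in fact a biautomatic and symmetric automatic one. -/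

import Mathlib

universe u

/-! ### Projective geometries -/

/-- A projective geometry, given by its points and lines: two distinct points lie on exactly one
line, the Veblen-Young axiom holds, and every line has at least three points. -/
structure ProjGeometry (P : Type u) where
  /-- The lines, as sets of points. -/
  lines : Set (Set P)
  existsUnique_line : ∀ p q : P, p ≠ q → ∃! l : Set P, l ∈ lines ∧ p ∈ l ∧ q ∈ l
  /-- If `a, b, c, d` are distinct points and the lines `ab` and `cd` meet, then so do the lines
  `ac` and `bd`. -/
  veblen_young : ∀ a b c d : P, a ≠ b → a ≠ c → a ≠ d → b ≠ c → b ≠ d → c ≠ d →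
    ∀ ab ∈ lines, ∀ cd ∈ lines, ∀ ac ∈ lines, ∀ bd ∈ lines,
      a ∈ ab → b ∈ ab → c ∈ cd → d ∈ cd → a ∈ ac → c ∈ ac → b ∈ bd → d ∈ bd →
      (ab ∩ cd).Nonempty → (ac ∩ bd).Nonempty
  three_points : ∀ l ∈ lines, ∃ p ∈ l, ∃ q ∈ l, ∃ r ∈ l, p ≠ q ∧ p ≠ r ∧ q ≠ r

namespace ProjGeometry

variable {P : Type u} (G : ProjGeometry P)

/-- A set of points is a subspace if it contains every line through two of its points. -/
def IsSubspace (X : Set P) : Prop :=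
  ∀ p ∈ X, ∀ q ∈ X, p ≠ q → ∀ l ∈ G.lines, p ∈ l → q ∈ l → l ⊆ X

/-- The poset of all subspaces, the empty one and the whole space included, ordered by
inclusion. -/
abbrev Subspace : Type u := {X : Set P // G.IsSubspace X}

/-- The whole space. -/
def whole : G.Subspace := ⟨Set.univ, fun _ _ _ _ _ _ _ _ _ => Set.subset_univ _⟩

/-- `G` has (projective) dimension `n`: the longest chains of subspaces from the empty subspace to
the whole space have length `n + 1`. -/
def HasDimension (n : ℕ) : Prop := Order.height G.whole = (n : ℕ∞) + 1

/-- The set `Π` of nontrivial proper subspaces, ordered by inclusion. -/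
abbrev Elem : Type u := {X : G.Subspace // X.1.Nonempty ∧ X.1 ≠ Set.univ}

variable {G}

/-- The linear dimension of `x ∈ Π` (a point has dimension `1`, a line dimension `2`, ...): the
length of the longest chains of subspaces from the empty subspace to `x`. -/
noncomputable def Elem.dim (x : G.Elem) : ℕ := (Order.height x.1).toNat

/-- Two elements of `Π` are incident if one contains the other. -/
def Elem.Incident (x y : G.Elem) : Prop := x ≤ y ∨ y ≤ x

/-- `x + y = V`: no element of `Π` contains both `x` and `y`. -/
def Elem.Spans (x y : G.Elem) : Prop := ¬ ∃ z : G.Elem, x ≤ z ∧ y ≤ z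

end ProjGeometry

open ProjGeometry in
/-- The half `𝒯'` of `𝒯`: the triples whose dimensions add up to `n + 1`. -/
def halfTriples {P : Type u} {G : ProjGeometry P} (n : ℕ) (T : Set (G.Elem × G.Elem × G.Elem)) :
    Set (G.Elem × G.Elem × G.Elem) :=
  {t | t ∈ T ∧ t.1.dim + t.2.1.dim + t.2.2.dim = n + 1}

/-- `lam` is an involution of `Π` that maps `Π_i` to `Π_{n+1-i}`, and `T` is an `Ã_n`-triangle
presentation compatible with `lam`. -/
structure IsTrianglePresentation {P : Type u} (G : ProjGeometry P) (n : ℕ)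
    (lam : G.Elem → G.Elem) (T : Set (G.Elem × G.Elem × G.Elem)) : Prop where
  involutive : Function.Involutive lam
  dim_lam : ∀ x, x.dim + (lam x).dim = n + 1
  axA : ∀ u v, (∃ w, (u, v, w) ∈ T) ↔ (lam u ≠ v ∧ (lam u).Incident v)
  axB : ∀ u v w, (u, v, w) ∈ T → (v, w, u) ∈ T
  axC : ∀ u v w₁ w₂, (u, v, w₁) ∈ T → (u, v, w₂) ∈ T → w₁ = w₂
  axD : ∀ u v w, (u, v, w) ∈ T → (lam w, lam v, lam u) ∈ T
  axE : ∀ u v w, (u, v, w) ∈ T →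
    u.dim + v.dim + w.dim = n + 1 ∨ u.dim + v.dim + w.dim = 2 * (n + 1)
  axF : ∀ x y u x' y', (x, y, u) ∈ halfTriples n T → (x', y', lam u) ∈ halfTriples n T →
    ∃ w, (y', x, w) ∈ halfTriples n T ∧ (y, x', lam w) ∈ halfTriples n T

/-! ### The group and its normal forms -/

/-- The relators `a_{λ(v)} a_v` for `v ∈ Π`, and `a_u a_v a_w` for `(u, v, w) ∈ 𝒯`. -/
def triangleRels {P : Type u} {G : ProjGeometry P} (lam : G.Elem → G.Elem)
    (T : Set (G.Elem × G.Elem × G.Elem)) : Set (FreeGroup G.Elem) :=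
  {r | ∃ v, r = FreeGroup.of (lam v) * FreeGroup.of v} ∪
  {r | ∃ u v w, (u, v, w) ∈ T ∧ r = FreeGroup.of u * FreeGroup.of v * FreeGroup.of w}

/-- The group `Γ_𝒯`. -/
abbrev TriangleGroup {P : Type u} {G : ProjGeometry P} (lam : G.Elem → G.Elem)
    (T : Set (G.Elem × G.Elem × G.Elem)) : Type u :=
  PresentedGroup (triangleRels lam T)

/-- The generator `a_v` of `Γ_𝒯`. -/
def triangleGen {P : Type u} {G : ProjGeometry P} (lam : G.Elem → G.Elem)
    (T : Set (G.Elem × G.Elem × G.Elem)) (v : G.Elem) : TriangleGroup lam T :=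
  PresentedGroup.of v

/-- The language `L` over `Π`: the strings `u₁ ⋯ u_ℓ` with `λ(u_i) + u_{i+1} = V` for all
`1 ≤ i < ℓ`. -/
def normalForms {P : Type u} {G : ProjGeometry P} (lam : G.Elem → G.Elem) : Language G.Elem :=
  {w | List.IsChain (fun u v => (lam u).Spans v) w}

/-! ### Words in a group, the word metric -/

/-- The element of `Γ` represented by a word over the alphabet `A`, where the letter `a` stands for
`π a`. -/
def wordEval {A Γ : Type u} [Group Γ] (π : A → Γ) (w : List A) : Γ := (w.map π).prod

/-- `w(t)`: the element represented by the prefix of length `t` of `w` (by all of `w` for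
`t` greater than the length of `w`). -/
def wordAt {A Γ : Type u} [Group Γ] (π : A → Γ) (w : List A) (t : ℕ) : Γ :=
  wordEval π (w.take t)

/-- The word length of `g`: the least length of a word that represents `g`. -/
noncomputable def wordLength {A Γ : Type u} [Group Γ] (π : A → Γ) (g : Γ) : ℕ :=
  sInf {m | ∃ w : List A, wordEval π w = g ∧ w.length = m}

/-- The word metric. -/
noncomputable def wordDist {A Γ : Type u} [Group Γ] (π : A → Γ) (g h : Γ) : ℕ :=
  wordLength π (g⁻¹ * h)

/-! ### Automatic and biautomatic groups -/

/-- The padded word over `(A ∪ {$})²` of a pair of words over `A`: the shorter word is padded at its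
end by the symbol `$ = none`. -/
def padPair {A : Type u} : List A → List A → List (Option A × Option A)
  | [], v => v.map fun b => (none, some b)
  | a :: u, [] => (some a, none) :: u.map fun a' => (some a', none)
  | a :: u, b :: v => (some a, some b) :: padPair u v

/-- The language of the padded pairs `(w₁, w₂)` of words of `L` with `g w₁ h = w₂` in `Γ`. -/
def multiplierLanguage {A Γ : Type u} [Group Γ] (π : A → Γ) (L : Language A) (g h : Γ) :
    Language (Option A × Option A) :=
  {z | ∃ w₁ ∈ L, ∃ w₂ ∈ L, g * wordEval π w₁ * h = wordEval π w₂ ∧ z = padPair w₁ w₂}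

/-- `L` is the language of an automatic structure on `Γ` over the finite alphabet `A`: it is regular
and maps onto `Γ`, and the languages that recognize equality and right multiplication by each
generator are regular. -/
structure IsAutomaticStructure {A Γ : Type u} [Group Γ] (π : A → Γ) (L : Language A) : Prop where
  finite : Finite A
  regular : L.IsRegular
  surjective : ∀ g : Γ, ∃ w ∈ L, wordEval π w = g
  regular_eq : (multiplierLanguage π L 1 1).IsRegular
  regular_mul_right : ∀ a : A, (multiplierLanguage π L 1 (π a)).IsRegular

/-- A biautomatic structure: left multiplication by each generator is recognized as well. -/
structure IsBiautomaticStructure {A Γ : Type u} [Group Γ] (π : A → Γ) (L : Language A) : Prop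
    extends IsAutomaticStructure π L where
  regular_mul_left : ∀ a : A, (multiplierLanguage π L (π a) 1).IsRegular

/-- `L` is symmetric: the alphabet is closed under inversion, the letter `inv a` standing for the
inverse of the letter `a`, and `L` contains the formal inverse of each of its words. -/
structure IsSymmetricLanguage {A Γ : Type u} [Group Γ] (π : A → Γ) (inv : A → A) (L : Language A) :
    Prop where
  involutive : Function.Involutive inv
  map_inv : ∀ a, π (inv a) = (π a)⁻¹
  inv_mem : ∀ w ∈ L, (w.map inv).reverse ∈ L

/-- `Γ` is automatic. -/
def IsAutomaticGroup (Γ : Type u) [Group Γ] : Prop :=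
  ∃ (A : Type u) (π : A → Γ) (L : Language A), IsAutomaticStructure π L

/-- `Γ` is biautomatic. -/
def IsBiautomaticGroup (Γ : Type u) [Group Γ] : Prop :=
  ∃ (A : Type u) (π : A → Γ) (L : Language A), IsBiautomaticStructure π L

/-- `Γ` is symmetric automatic: it has an automatic structure with a symmetric language. -/
def IsSymmetricAutomaticGroup (Γ : Type u) [Group Γ] : Prop :=
  ∃ (A : Type u) (π : A → Γ) (inv : A → A) (L : Language A),
    IsAutomaticStructure π L ∧ IsSymmetricLanguage π inv L

/-! The group behaves like a Garside group in which the central Garside element is set to `1`. Order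
the subspaces by reverse inclusion, so that `⊥` is the whole space and `⊤` the empty one. The
triangles of dimension sum `2 (n + 1)` define a partial product: `u v = λ(w)` when `v` properly
contains `λ(u)`. Further, `⊥` is the unit and `u λ(u) = ⊤`. Axiom (F), carried over by (D), is
associativity, and `⊤` is central because `λ` is an involution. The other half of the triangles only
gives the inverted relations.

The condition `λ(u) + v = V` now reads `comp u ⊓ v = ⊥`: the pair is left greedy, as `u` can absorb
no nontrivial left divisor of `v`. So `L` consists of the greedy words without `⊥` and `⊤`. To
multiply such a word by a letter, renormalize adjacent pairs in a single pass; the domino rules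
`Greedy.head_head` (on the left) and `Greedy.rest_rest` (on the right) show that one pass suffices.
Prefixes then change by one simple element, which is the fellow traveller property, and right
multiplication lengthens a word by at most one, which makes `L` geodesic.

Uniqueness comes from an action on infinite greedy words modulo leading letters `⊤` (`head_mul`,
`leftMul_consSeq_top`): a normal word is recovered from the image of the trivial word
(`eq_of_prod_perm_eq`). Regularity of the multiplier languages follows since an automaton need only
remember a bounded group element (`isRegular_multiplierLanguage`). -/

/-! ### Garside germs with a central Garside element -/

/-- A lattice of simple elements with a partial product: `mul x y` is meaningful for `y ≤ comp x`,
`x ≤ z` means that `x` divides `z` on the left, and `⊤` is the Garside element, with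
`mul x (comp x) = ⊤` for an involution `comp`. -/
structure GarsideGerm (S : Type u) [SemilatticeInf S] [BoundedOrder S] where
  comp : S → S
  mul : S → S → S
  comp_comp : ∀ x, comp (comp x) = x
  bot_mul : ∀ x, mul ⊥ x = x
  mul_bot : ∀ x, mul x ⊥ = x
  mul_comp : ∀ x, mul x (comp x) = ⊤
  le_mul : ∀ x y, y ≤ comp x → x ≤ mul x y
  exists_mul_eq : ∀ x z, x ≤ z → ∃ y, y ≤ comp x ∧ mul x y = z
  mul_left_cancel : ∀ x y z, y ≤ comp x → z ≤ comp x → mul x y = mul x z → y = z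
  assoc : ∀ x y z, y ≤ comp x → z ≤ comp (mul x y) →
    z ≤ comp y ∧ mul y z ≤ comp x ∧ mul (mul x y) z = mul x (mul y z)

/-! ### Divisibility and cancellation in a germ -/

namespace GarsideGerm

variable {S : Type u} [SemilatticeInf S] [BoundedOrder S] (M : GarsideGerm S)

theorem comp_bot : M.comp ⊥ = ⊤ := by
  rw [← M.bot_mul (M.comp ⊥), M.mul_comp]

theorem comp_top : M.comp ⊤ = ⊥ := by
  rw [← M.comp_bot, M.comp_comp]

theorem comp_injective : Function.Injective M.comp :=
  Function.LeftInverse.injective M.comp_comp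

theorem comp_eq_bot {x : S} : M.comp x = ⊥ ↔ x = ⊤ := by
  rw [← M.comp_top, M.comp_injective.eq_iff]

open Classical in
/-- The quotient `x⁻¹ z` for `x ≤ z`. -/
noncomputable def quot (x z : S) : S :=
  if h : x ≤ z then (M.exists_mul_eq x z h).choose else ⊥

variable {M}

theorem quot_le {x z : S} (h : x ≤ z) : M.quot x z ≤ M.comp x := by
  rw [quot, dif_pos h]
  exact (M.exists_mul_eq x z h).choose_spec.1

theorem mul_quot {x z : S} (h : x ≤ z) : M.mul x (M.quot x z) = z := by
  rw [quot, dif_pos h]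
  exact (M.exists_mul_eq x z h).choose_spec.2

theorem quot_eq {x y z : S} (h : y ≤ M.comp x) (e : M.mul x y = z) : M.quot x z = y := by
  have hx : x ≤ z := e ▸ M.le_mul x y h
  exact M.mul_left_cancel x _ _ (quot_le hx) h ((mul_quot hx).trans e.symm)

theorem mul_eq_top {x y : S} (h : y ≤ M.comp x) : M.mul x y = ⊤ ↔ y = M.comp x :=
  ⟨fun e => M.mul_left_cancel x _ _ h le_rfl (e.trans (M.mul_comp x).symm),
    fun e => e ▸ M.mul_comp x⟩

theorem comp_mul_le {x y : S} (h : y ≤ M.comp x) : M.comp (M.mul x y) ≤ M.comp y :=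
  (M.assoc x y _ h le_rfl).1

/-- Both sides complete `x` to `⊤`, since `x y comp(x y) = ⊤`, and the complement is unique. -/
theorem mul_comp_mul {x y : S} (h : y ≤ M.comp x) : M.mul y (M.comp (M.mul x y)) = M.comp x := by
  obtain ⟨-, h2, h3⟩ := M.assoc x y _ h le_rfl
  rw [M.mul_comp] at h3
  exact (mul_eq_top h2).1 h3.symm

theorem mul_le_mul_iff {x y z : S} (hy : y ≤ M.comp x) (hz : z ≤ M.comp x) :
    M.mul x y ≤ M.mul x z ↔ y ≤ z := by
  constructor
  · intro h
    obtain ⟨t, ht, e⟩ := M.exists_mul_eq _ _ h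
    obtain ⟨h1, h2, h3⟩ := M.assoc x y t hy ht
    rw [← M.mul_left_cancel x _ _ h2 hz (h3.symm.trans e)]
    exact M.le_mul _ _ h1
  · intro h
    obtain ⟨t, ht, rfl⟩ := M.exists_mul_eq _ _ h
    -- To regroup `x (y t)`, extend `y t` by `w` to `comp x`; cancelling `y` in `y (t w) = y comp(x
    -- y)` shows that `t` divides `comp(x y)`.
    have : t ≤ M.comp (M.mul x y) := by
      obtain ⟨w, hw, e⟩ := M.exists_mul_eq _ _ hz
      obtain ⟨h1, h2, h3⟩ := M.assoc _ _ _ ht hw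
      have e' : M.mul t w = M.comp (M.mul x y) := by
        refine M.mul_left_cancel y _ _ h2 (comp_mul_le hy) ?_
        rw [← h3, e, mul_comp_mul hy]
      rw [← e']
      exact M.le_mul _ _ h1
    rw [← (M.assoc x y t hy this).2.2]
    exact M.le_mul _ _ this

theorem assoc_symm {x y z : S} (hz : z ≤ M.comp y) (h : M.mul y z ≤ M.comp x) :
    y ≤ M.comp x ∧ z ≤ M.comp (M.mul x y) ∧ M.mul (M.mul x y) z = M.mul x (M.mul y z) := by
  have hy : y ≤ M.comp x := (M.le_mul _ _ hz).trans h
  have hz' : z ≤ M.comp (M.mul x y) := by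
    rw [← mul_comp_mul hy] at h
    exact (mul_le_mul_iff hz (comp_mul_le hy)).1 h
  exact ⟨hy, hz', (M.assoc x y z hy hz').2.2⟩

theorem mul_right_cancel {x x' y : S} (h : y ≤ M.comp x) (h' : y ≤ M.comp x')
    (e : M.mul x y = M.mul x' y) : x = x' := by
  apply M.comp_injective
  rw [← mul_comp_mul h, ← mul_comp_mul h', e]

/-- Complementation turns right divisibility into the reversed order: with `x = comp(y comp z)` one
has `x y comp z = ⊤`, hence `x y = z`. -/
theorem exists_mul_eq_of_comp_le {y z : S} (h : M.comp z ≤ M.comp y) :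
    ∃ x, y ≤ M.comp x ∧ M.mul x y = z := by
  obtain ⟨h1, h2, h3⟩ := assoc_symm (M := M) (x := M.comp (M.mul y (M.comp z))) h
    (by rw [M.comp_comp])
  refine ⟨_, h1, ?_⟩
  have : M.mul (M.comp (M.mul y (M.comp z))) (M.mul y (M.comp z)) = ⊤ := by
    conv_lhs => rw [← M.comp_comp (M.mul y (M.comp z))]
    rw [M.comp_comp (M.mul y (M.comp z)), mul_eq_top (by rw [M.comp_comp]), M.comp_comp]
  rw [this, mul_eq_top h2] at h3
  exact M.comp_injective h3.symm

theorem mul_inf {x y z : S} (hy : y ≤ M.comp x) (hz : z ≤ M.comp x) :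
    M.mul x (y ⊓ z) = M.mul x y ⊓ M.mul x z := by
  have hyz : y ⊓ z ≤ M.comp x := inf_le_left.trans hy
  refine le_antisymm (le_inf ((mul_le_mul_iff hyz hy).2 inf_le_left)
    ((mul_le_mul_iff hyz hz).2 inf_le_right)) ?_
  have hx : x ≤ M.mul x y ⊓ M.mul x z := le_inf (M.le_mul _ _ hy) (M.le_mul _ _ hz)
  obtain ⟨t, ht, e⟩ := M.exists_mul_eq _ _ hx
  rw [← e]
  refine (mul_le_mul_iff ht hyz).2 (le_inf ?_ ?_)
  · exact (mul_le_mul_iff ht hy).1 (e ▸ inf_le_left)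
  · exact (mul_le_mul_iff ht hz).1 (e ▸ inf_le_right)

theorem quot_bot (z : S) : M.quot ⊥ z = z :=
  quot_eq (by simp [M.comp_bot]) (M.bot_mul z)

theorem quot_comp_top (x : S) : M.quot (M.comp x) ⊤ = x := by
  refine quot_eq (by rw [M.comp_comp]) ?_
  conv_lhs => rw [← M.comp_comp x]
  rw [M.comp_comp x, mul_eq_top (by rw [M.comp_comp]), M.comp_comp]

theorem eq_top_of_quot_eq_top {x z : S} (h : x ≤ z) (e : M.quot x z = ⊤) : x = ⊥ ∧ z = ⊤ := by
  have h1 := quot_le (M := M) h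
  rw [e, top_le_iff, ← M.comp_bot, M.comp_injective.eq_iff] at h1
  subst h1
  rw [quot_bot] at e
  exact ⟨rfl, e⟩

/-! ### Normal words -/

variable (M)

/-- The maximal left divisor of `y` that `x` can absorb. -/
def slide (x y : S) : S := M.comp x ⊓ y

/-- The first letter of the normal form of `x y`. -/
def head (x y : S) : S := M.mul x (M.slide x y)

/-- The second letter of the normal form of `x y`. -/
noncomputable def rest (x y : S) : S := M.quot (M.slide x y) y

/-- The pair `x, y` is left greedy. -/
def Greedy (x y : S) : Prop := M.comp x ⊓ y = ⊥

variable {M}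

theorem slide_le_comp (x y : S) : M.slide x y ≤ M.comp x := inf_le_left

theorem slide_le (x y : S) : M.slide x y ≤ y := inf_le_right

theorem rest_le (x y : S) : M.rest x y ≤ M.comp (M.slide x y) := quot_le (slide_le x y)

theorem slide_mul_rest (x y : S) : M.mul (M.slide x y) (M.rest x y) = y := mul_quot (slide_le x y)

theorem rest_ne_top {x y : S} (h : x ≠ ⊤) : M.rest x y ≠ ⊤ := by
  intro e
  obtain ⟨h1, h2⟩ := eq_top_of_quot_eq_top (slide_le x y) e
  rw [slide, h2, inf_top_eq, M.comp_eq_bot] at h1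
  exact h h1

theorem rest_ne_top' {x y : S} (h : y ≠ ⊤) : M.rest x y ≠ ⊤ :=
  fun e => h (eq_top_of_quot_eq_top (slide_le x y) e).2

theorem comp_head_inf_mul {x m y : S} (hm : m ≤ M.comp x) (hy : y ≤ M.comp m) :
    M.mul m (M.comp (M.mul x m) ⊓ y) = M.comp x ⊓ M.mul m y := by
  rw [mul_inf (comp_mul_le hm) hy, mul_comp_mul hm]

/-- The slid part is the largest that `x` can absorb; anything more absorbed from the rest would,
multiplied by the slid part, still divide `comp x ⊓ y`. -/
theorem greedy_head_rest (x y : S) : M.Greedy (M.head x y) (M.rest x y) := by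
  have h := comp_head_inf_mul (slide_le_comp (M := M) x y) (rest_le x y)
  rw [slide_mul_rest] at h
  refine M.mul_left_cancel (M.slide x y) _ _ (inf_le_right.trans (rest_le x y)) bot_le ?_
  rw [M.mul_bot]
  exact h

theorem Greedy.slide_eq {x y : S} (h : M.Greedy x y) : M.slide x y = ⊥ := h

theorem Greedy.head_eq {x y : S} (h : M.Greedy x y) : M.head x y = x := by
  rw [head, h.slide_eq, M.mul_bot]

theorem Greedy.rest_eq {x y : S} (h : M.Greedy x y) : M.rest x y = y := by
  rw [rest, h.slide_eq, quot_bot]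

theorem greedy_bot (x : S) : M.Greedy x ⊥ := inf_bot_eq _

theorem Greedy.eq_bot {y : S} (h : M.Greedy ⊥ y) : y = ⊥ := by
  rwa [Greedy, M.comp_bot, top_inf_eq] at h

/-- If `m r | y` is greedy, then `m` absorbs no more of `r y` than `r`. -/
theorem Greedy.comp_inf_head {m r y : S} (hr : r ≤ M.comp m) (h : M.Greedy (M.mul m r) y) :
    M.comp m ⊓ M.head r y = r := by
  have hs := slide_le_comp (M := M) r y
  obtain ⟨q, hq, e⟩ := M.exists_mul_eq _ _ (le_inf hr (M.le_mul _ _ hs))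
  have h1 : q ≤ M.comp (M.mul m r) := (assoc_symm hq (e ▸ inf_le_left)).2.1
  have h2 : q ≤ M.slide r y := (mul_le_mul_iff hq hs).1 (e ▸ inf_le_right)
  have h3 : q ≤ ⊥ := by
    rw [← h]
    exact le_inf h1 (h2.trans (slide_le r y))
  rw [le_bot_iff] at h3
  rw [h3, M.mul_bot] at e
  exact e.symm

/-- The first domino rule. -/
theorem Greedy.head_head {x y z : S} (h : M.Greedy y z) :
    M.Greedy (M.head x y) (M.head (M.rest x y) z) := by
  have h1 : M.Greedy (M.mul (M.slide x y) (M.rest x y)) z := by rwa [slide_mul_rest]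
  have h2 := h1.comp_inf_head (rest_le x y)
  -- The slid part divides the head on the right, so whatever the head absorbs lies below its
  -- complement, where `h2` leaves only `rest x y` of the second letter.
  have h3 := comp_mul_le (slide_le_comp (M := M) x y)
  rw [Greedy, ← le_bot_iff, ← greedy_head_rest x y]
  refine le_inf inf_le_left ?_
  conv_rhs => rw [← h2]
  exact inf_le_inf_right _ h3

/-- Write `y = s r` with `s` the slid part and `r` the rest. If `r` could absorb enough of `z` to
become `⊤`, then `r = comp s`, and so `y = ⊤`. -/
theorem head_rest_ne_top {x y z : S} (h : M.Greedy y z) (hy : y ≠ ⊤) :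
    M.head (M.rest x y) z ≠ ⊤ := by
  intro e
  have h1 : M.Greedy (M.mul (M.slide x y) (M.rest x y)) z := by rwa [slide_mul_rest]
  have h2 := h1.comp_inf_head (rest_le x y)
  rw [e, inf_top_eq] at h2
  apply hy
  rw [← slide_mul_rest (M := M) x y, mul_eq_top (rest_le x y), h2]

/-- If `m p = u n` where `m` and `u` have no common left divisor, then `m p` is the least common
left multiple of `p` and `n`. -/
theorem comp_mul_eq_inf {m p u n : S} (hp : p ≤ M.comp m) (hn : n ≤ M.comp u)
    (e : M.mul m p = M.mul u n) (h : m ⊓ u = ⊥) :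
    M.comp (M.mul m p) = M.comp p ⊓ M.comp n := by
  -- `E = a p = b n` is the least common left multiple. From `m p = k E`, cancellation on the right
  -- gives `m = k a` and `u = k b`, so `k` divides `m ⊓ u = ⊥`.
  set E := M.comp (M.comp p ⊓ M.comp n) with hE
  have hE' : M.comp E = M.comp p ⊓ M.comp n := by rw [hE, M.comp_comp]
  have h0 : M.comp (M.mul m p) ≤ M.comp E := by
    rw [hE']
    exact le_inf (comp_mul_le hp) (e ▸ comp_mul_le hn)
  obtain ⟨a, ha, ea⟩ := exists_mul_eq_of_comp_le (M := M) (y := p) (z := E) (hE' ▸ inf_le_left)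
  obtain ⟨b, hb, eb⟩ := exists_mul_eq_of_comp_le (M := M) (y := n) (z := E) (hE' ▸ inf_le_right)
  obtain ⟨k, hk, ek⟩ := exists_mul_eq_of_comp_le h0
  obtain ⟨a1, a2, a3⟩ := assoc_symm ha (ea.symm ▸ hk)
  obtain ⟨b1, b2, b3⟩ := assoc_symm hb (eb.symm ▸ hk)
  rw [ea, ek] at a3
  rw [eb, ek, e] at b3
  have ka := M.le_mul _ _ a1
  have kb := M.le_mul _ _ b1
  rw [mul_right_cancel a2 hp a3] at ka
  rw [mul_right_cancel b2 hn b3] at kb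
  have hk0 : k = ⊥ := le_bot_iff.1 (h ▸ le_inf ka kb)
  rw [← hE', ← ek, hk0, M.bot_mul]

/-- The second domino rule. -/
theorem Greedy.rest_rest {x y z : S} (h : M.Greedy x y) :
    M.Greedy (M.rest x (M.head y z)) (M.rest y z) := by
  -- Two factorizations of `head y z` whose left factors have no common divisor, because the first
  -- divides `comp x` and `x, y` is greedy.
  have e : M.mul (M.slide x (M.head y z)) (M.rest x (M.head y z)) = M.mul y (M.slide y z) :=
    slide_mul_rest _ _
  have h0 : M.slide x (M.head y z) ⊓ y = ⊥ := by
    rw [← le_bot_iff, ← h]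
    exact inf_le_inf_right _ (slide_le_comp _ _)
  have h1 := comp_mul_eq_inf (rest_le _ _) (slide_le_comp y z) e h0
  rw [slide_mul_rest] at h1
  rw [Greedy, ← le_bot_iff, ← greedy_head_rest y z, h1]
  exact le_inf (le_inf inf_le_left (inf_le_right.trans (rest_le y z))) inf_le_right

end GarsideGerm

namespace GarsideGerm

variable {S : Type u} [SemilatticeInf S] [BoundedOrder S] {M : GarsideGerm S}

/-! ### Left multiplication of infinite words, and uniqueness of normal forms -/

variable (M)

/-- What remains of the factor `x` after it has been moved past the first `n` letters of `u`. -/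
noncomputable def carry (x : S) (u : ℕ → S) : ℕ → S
  | 0 => x
  | n + 1 => M.rest (carry x u n) (u n)

/-- Left multiplication of an infinite word by `x`. -/
noncomputable def leftMul (x : S) (u : ℕ → S) (n : ℕ) : S := M.head (M.carry x u n) (u n)

/-- Adds the letter `a` in front of an infinite word. -/
def consSeq (a : S) (u : ℕ → S) : ℕ → S
  | 0 => a
  | n + 1 => u n

variable {M}

/-- Moving `x y` past `a` amounts to moving `y` past `a` and then `x` past the new head. This makes
left multiplication of sequences compatible with the product. -/
theorem head_mul {x y a : S} (h : y ≤ M.comp x) :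
    M.head (M.mul x y) a = M.head x (M.head y a) ∧
      M.rest y a ≤ M.comp (M.rest x (M.head y a)) ∧
      M.rest (M.mul x y) a = M.mul (M.rest x (M.head y a)) (M.rest y a) := by
  have hs : M.slide (M.mul x y) a ≤ M.slide y a := inf_le_inf_right _ (comp_mul_le h)
  have hsc := slide_le_comp (M := M) (M.mul x y) a
  -- What `x y` absorbs of `a`, preceded by `y`, is what `x` absorbs of the head of `y a`.
  have e1 : M.mul y (M.slide (M.mul x y) a) = M.slide x (M.head y a) := by
    have : M.slide (M.mul x y) a = M.comp (M.mul x y) ⊓ M.slide y a := by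
      rw [slide, slide, ← inf_assoc, inf_eq_left.2 (comp_mul_le h)]
    rw [this, mul_inf (comp_mul_le h) (slide_le_comp y a), mul_comp_mul h]
    rfl
  obtain ⟨a1, a2, a3⟩ := M.assoc x y _ h hsc
  have e2 : M.mul (M.mul y (M.slide (M.mul x y) a)) (M.rest x (M.head y a)) = M.head y a := by
    rw [e1, slide_mul_rest]
  have hr : M.rest x (M.head y a) ≤ M.comp (M.mul y (M.slide (M.mul x y) a)) := by
    rw [e1]
    exact rest_le _ _
  obtain ⟨b1, b2, b3⟩ := M.assoc y _ _ a1 hr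
  have e3 : M.mul (M.slide (M.mul x y) a) (M.rest x (M.head y a)) = M.slide y a :=
    M.mul_left_cancel y _ _ b2 (slide_le_comp y a) (b3.symm.trans e2)
  obtain ⟨c1, c2, c3⟩ := M.assoc _ _ (M.rest y a) b1 (by rw [e3]; exact rest_le y a)
  refine ⟨?_, c1, ?_⟩
  · rw [head, a3, e1]
    rfl
  · refine quot_eq c2 ?_
    rw [← c3, e3, slide_mul_rest]

theorem leftMul_mul {x y : S} (h : y ≤ M.comp x) (u : ℕ → S) :
    M.leftMul (M.mul x y) u = M.leftMul x (M.leftMul y u) := by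
  have key : ∀ n, M.carry y u n ≤ M.comp (M.carry x (M.leftMul y u) n) ∧
      M.carry (M.mul x y) u n = M.mul (M.carry x (M.leftMul y u) n) (M.carry y u n) := by
    intro n
    induction n with
    | zero => exact ⟨h, rfl⟩
    | succ n ih =>
      obtain ⟨-, h2, h3⟩ := head_mul (M := M) (a := u n) ih.1
      refine ⟨h2, ?_⟩
      rw [carry, ih.2]
      exact h3
  funext n
  rw [leftMul, (key n).2]
  exact (head_mul (key n).1).1

/-- This is centrality of `⊤`: `x` absorbs `comp x` from `⊤`, and the remainder is again `x` because
`comp` is an involution. -/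
theorem leftMul_consSeq_top (x : S) (u : ℕ → S) :
    M.leftMul x (consSeq ⊤ u) = consSeq ⊤ (M.leftMul x u) := by
  have hs : ∀ x, M.slide x ⊤ = M.comp x := fun x => inf_top_eq _
  have key : ∀ n, M.carry x (consSeq ⊤ u) (n + 1) = M.carry x u n := by
    intro n
    induction n with
    | zero =>
      change M.quot (M.slide x ⊤) ⊤ = x
      rw [hs, quot_comp_top]
    | succ n ih =>
      change M.rest (M.carry x (consSeq ⊤ u) (n + 1)) (u n) = _
      rw [ih]
      rfl
  funext n
  cases n with
  | zero =>
    change M.mul x (M.slide x ⊤) = ⊤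
    rw [hs, M.mul_comp]
  | succ n =>
    change M.head (M.carry x (consSeq ⊤ u) (n + 1)) (u n) = _
    rw [key]
    rfl

theorem leftMul_eq_consSeq {a : S} {u : ℕ → S} (ha : M.Greedy a (u 0))
    (hu : ∀ n, M.Greedy (u n) (u (n + 1))) : M.leftMul a u = consSeq a u := by
  have hg : ∀ n, M.Greedy (consSeq a u n) (u n)
    | 0 => ha
    | n + 1 => hu n
  have key : ∀ n, M.carry a u n = consSeq a u n := by
    intro n
    induction n with
    | zero => rfl
    | succ n ih => rw [carry, ih, (hg n).rest_eq, consSeq]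
  funext n
  rw [leftMul, key, (hg n).head_eq]

/-! ### Greedy sequences modulo leading letters `⊤` -/

variable (M)

/-- The infinite left greedy words. -/
def GreedySeq : Type u := {u : ℕ → S // ∀ n, M.Greedy (u n) (u (n + 1))}

variable {M}

theorem greedy_top (x : S) : M.Greedy ⊤ x := by
  rw [Greedy, M.comp_top, bot_inf_eq]

namespace GreedySeq

/-- Left multiplication of a greedy infinite word. -/
noncomputable def leftMul (x : S) (u : M.GreedySeq) : M.GreedySeq :=
  ⟨M.leftMul x u.1, fun n => (u.2 n).head_head⟩

/-- Greedy infinite words up to leading letters `⊤`. -/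
def Rel (u v : M.GreedySeq) : Prop := v = leftMul ⊤ u

theorem leftMul_top_val (u : M.GreedySeq) : (leftMul ⊤ u).1 = consSeq ⊤ u.1 :=
  leftMul_eq_consSeq (greedy_top _) u.2

theorem leftMul_mul {x y : S} (h : y ≤ M.comp x) (u : M.GreedySeq) :
    leftMul (M.mul x y) u = leftMul x (leftMul y u) :=
  Subtype.ext (GarsideGerm.leftMul_mul h u.1)

theorem Rel.leftMul {u v : M.GreedySeq} (h : Rel u v) (x : S) :
    Rel (u.leftMul x) (v.leftMul x) := by
  subst h
  apply Subtype.ext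
  rw [leftMul_top_val]
  change M.leftMul x _ = consSeq ⊤ (M.leftMul x u.1)
  rw [leftMul_top_val, leftMul_consSeq_top]

/-- Greedy infinite words up to leading letters `⊤`. -/
def Class (M : GarsideGerm S) : Type u := Quot (Rel (M := M))

/-- Left multiplication on classes of greedy infinite words. -/
noncomputable def Class.leftMul (x : S) : Class M → Class M :=
  Quot.map (GreedySeq.leftMul x) fun _ _ h => h.leftMul x

theorem Class.leftMul_mul {x y : S} (h : y ≤ M.comp x) (c : Class M) :
    leftMul (M.mul x y) c = leftMul x (leftMul y c) := by
  induction c using Quot.ind with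
  | mk u => exact congrArg _ (GreedySeq.leftMul_mul h u)

theorem Class.leftMul_top (c : Class M) : leftMul ⊤ c = c := by
  induction c using Quot.ind with
  | mk u =>
    exact (Quot.sound (r := Rel) rfl :
      Quot.mk Rel u = Quot.mk Rel (GreedySeq.leftMul ⊤ u)).symm

/-- Left multiplication as a permutation of the classes of greedy infinite words. -/
noncomputable def Class.perm (x : S) : Equiv.Perm (Class M) where
  toFun := leftMul x
  invFun := leftMul (M.comp x)
  left_inv c := by
    have h := M.mul_comp (M.comp x)
    rw [M.comp_comp] at h
    rw [← leftMul_mul (by rw [M.comp_comp]), h, leftMul_top]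
  right_inv c := by
    rw [← leftMul_mul le_rfl, M.mul_comp, leftMul_top]

theorem Class.perm_mul {x y : S} (h : y ≤ M.comp x) :
    perm (M := M) (M.mul x y) = perm x * perm y :=
  Equiv.ext fun c => leftMul_mul h c

theorem Class.perm_top : perm (M := M) ⊤ = 1 :=
  Equiv.ext fun c => leftMul_top c

/-- Removes the leading letters `⊤`. -/
noncomputable def strip (u : ℕ → S) (n : ℕ) : S := u (n + sInf {k | u k ≠ ⊤})

theorem strip_consSeq_top (u : ℕ → S) : strip (consSeq ⊤ u) = strip u := by
  have e : {k | consSeq ⊤ u k ≠ ⊤} = (· + 1) '' {k | u k ≠ ⊤} := by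
    ext k
    cases k with
    | zero => simp [consSeq]
    | succ k => simp [consSeq]
  funext n
  rw [strip, e, strip]
  rcases Set.eq_empty_or_nonempty {k | u k ≠ ⊤} with h | h
  -- If all letters are `⊤`, the infimum over the empty set is `0`; both sequences are constant
  -- anyway.
  · have h' : ∀ k, u k = ⊤ := by simpa [Set.eq_empty_iff_forall_notMem] using h
    rw [h, h']
    cases n with
    | zero => simp [consSeq]
    | succ n => simp [consSeq, h']
  · have : sInf ((· + 1) '' {k | u k ≠ ⊤}) = sInf {k | u k ≠ ⊤} + 1 := by
      apply le_antisymm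
      · exact Nat.sInf_le ⟨_, Nat.sInf_mem h, rfl⟩
      · refine le_csInf (h.image _) ?_
        rintro _ ⟨k, hk, rfl⟩
        exact Nat.succ_le_succ (Nat.sInf_le hk)
    rw [this]
    rfl

theorem strip_eq {u : ℕ → S} (h : u 0 ≠ ⊤) : strip u = u := by
  have : sInf {k | u k ≠ ⊤} = 0 := Nat.sInf_eq_zero.2 (Or.inl h)
  funext n
  rw [strip, this, add_zero]

/-- The canonical representative of a class. -/
noncomputable def Class.rep : Class M → ℕ → S :=
  Quot.lift (fun u => strip u.1) fun u v h => by
    rw [show v.1 = consSeq ⊤ u.1 from (congrArg _ h).trans (leftMul_top_val u),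
      strip_consSeq_top]

end GreedySeq

/-! ### Finite greedy words as classes of sequences -/

/-- A finite word as an infinite one. -/
def padSeq (w : List S) (n : ℕ) : S := w.getD n ⊥

theorem padSeq_cons (a : S) (w : List S) : padSeq (a :: w) = consSeq a (padSeq w) := by
  funext n
  cases n <;> simp [padSeq, consSeq]

theorem padSeq_greedy {w : List S} (hw : w.IsChain M.Greedy) (n : ℕ) :
    M.Greedy (padSeq w n) (padSeq w (n + 1)) := by
  by_cases h : n + 1 < w.length
  · have := List.isChain_iff_getElem.1 hw n h
    rwa [← List.getD_eq_getElem _ ⊥, ← List.getD_eq_getElem _ ⊥] at this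
  · rw [show padSeq w (n + 1) = ⊥ from List.getD_eq_default _ _ (not_lt.1 h)]
    exact greedy_bot _

theorem padSeq_injective : ∀ {v w : List S}, ⊥ ∉ v → ⊥ ∉ w → padSeq v = padSeq w → v = w
  | [], [], _, _, _ => rfl
  | [], b :: w, _, hw, e => by
    have := congrFun e 0
    simp [padSeq] at this
    simp [← this] at hw
  | a :: v, [], hv, _, e => by
    have := congrFun e 0
    simp [padSeq] at this
    simp [this] at hv
  | a :: v, b :: w, hv, hw, e => by
    rw [padSeq_cons, padSeq_cons] at e
    have h0 : a = b := congrFun e 0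
    have h1 : padSeq v = padSeq w := funext fun n => congrFun e (n + 1)
    rw [h0, padSeq_injective (fun h => hv (List.mem_cons_of_mem _ h))
      (fun h => hw (List.mem_cons_of_mem _ h)) h1]

/-- The class of a finite greedy word. -/
def GreedySeq.Class.ofList (w : List S) (hw : w.IsChain M.Greedy) : GreedySeq.Class M :=
  Quot.mk _ ⟨padSeq w, padSeq_greedy hw⟩

/-- Applied to the trivial word, a greedy word rebuilds itself: each letter is put in front of a
word with which it is already greedy. -/
theorem prod_perm_apply : ∀ {w : List S} (hw : w.IsChain M.Greedy),
    (w.map (GreedySeq.Class.perm (M := M))).prod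
      (GreedySeq.Class.ofList [] List.isChain_nil) = GreedySeq.Class.ofList w hw
  | [], _ => rfl
  | a :: w, hw => by
    have hw' : w.IsChain M.Greedy := hw.tail
    rw [List.map_cons, List.prod_cons, Equiv.Perm.mul_apply, prod_perm_apply hw']
    refine congrArg (Quot.mk _) (Subtype.ext ?_)
    change M.leftMul a (padSeq w) = padSeq (a :: w)
    have h0 := padSeq_greedy hw 0
    rw [padSeq_cons] at h0 ⊢
    exact leftMul_eq_consSeq h0 (padSeq_greedy hw')

/-- Normal words without letters `⊥` and `⊤` are determined by their action on the greedy infinite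
words. -/
theorem eq_of_prod_perm_eq [Nontrivial S] {v w : List S} (hv : v.IsChain M.Greedy)
    (hw : w.IsChain M.Greedy) (bv : ⊥ ∉ v) (bw : ⊥ ∉ w) (tv : ⊤ ∉ v) (tw : ⊤ ∉ w)
    (h : (v.map (GreedySeq.Class.perm (M := M))).prod =
      (w.map (GreedySeq.Class.perm (M := M))).prod) : v = w := by
  -- The first entry is a letter of `w` or the padding `⊥`, which differs from `⊤` as `S` is
  -- nontrivial.
  have key : ∀ {w : List S}, ⊤ ∉ w → GreedySeq.strip (padSeq w) = padSeq w := by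
    intro w tw
    apply GreedySeq.strip_eq
    cases w with
    | nil => simp [padSeq]
    | cons a w =>
      simp only [List.mem_cons, not_or] at tw
      simpa [padSeq] using Ne.symm tw.1
  have e := congrArg GreedySeq.Class.rep
    ((prod_perm_apply hv).symm.trans ((DFunLike.congr_fun h _).trans (prod_perm_apply hw)))
  change GreedySeq.strip (padSeq v) = GreedySeq.strip (padSeq w) at e
  rw [key tv, key tw] at e
  exact padSeq_injective bv bw e

end GarsideGerm

/-! ### Words in a group -/

section Words

variable {A Γ : Type u} [Group Γ] (π : A → Γ)

theorem wordEval_nil : wordEval π [] = 1 := rfl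

theorem wordEval_cons (a : A) (w : List A) : wordEval π (a :: w) = π a * wordEval π w :=
  List.prod_cons

theorem wordEval_append (v w : List A) : wordEval π (v ++ w) = wordEval π v * wordEval π w := by
  simp [wordEval]

theorem wordAt_zero (w : List A) : wordAt π w 0 = 1 := rfl

theorem wordAt_nil (t : ℕ) : wordAt π [] t = 1 := by
  rw [wordAt, List.take_nil, wordEval_nil]

theorem wordAt_cons_succ (a : A) (w : List A) (t : ℕ) :
    wordAt π (a :: w) (t + 1) = π a * wordAt π w t := by
  rw [wordAt, List.take_succ_cons, wordEval_cons]
  rfl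

theorem wordAt_of_length_le {w : List A} {t : ℕ} (h : w.length ≤ t) :
    wordAt π w t = wordEval π w := by
  rw [wordAt, List.take_of_length_le h]

theorem wordEval_eq_of_wordAt {v w : List A}
    (h : (∀ t, wordAt π v t = wordAt π w t) ∨ ∀ t, wordAt π v t = wordAt π w (t + 1)) :
    wordEval π v = wordEval π w := by
  rw [← wordAt_of_length_le π (le_max_left v.length w.length)]
  rcases h with h | h
  · rw [h, wordAt_of_length_le π (le_max_right _ _)]
  · rw [h, wordAt_of_length_le π ((le_max_right _ _).trans (Nat.le_succ _))]

end Words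

namespace GarsideGerm

variable {S : Type u} [SemilatticeInf S] [BoundedOrder S] {M : GarsideGerm S}

/-! ### Multiplication of finite normal words by a letter -/

variable (M)

/-- Right multiplication of a word by a letter: the first letter of the result and the others. -/
noncomputable def rightMulList (x : S) : List S → S × List S
  | [] => (x, [])
  | a :: u => (M.head a (rightMulList x u).1,
      M.rest a (rightMulList x u).1 :: (rightMulList x u).2)

/-- Left multiplication of a word by a letter. -/
noncomputable def leftMulList : S → List S → List S
  | x, [] => [x]
  | x, a :: u => M.head x a :: leftMulList (M.rest x a) u

/-- The words without letters `⊥` and `⊤` all of whose pairs of consecutive letters are greedy. -/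
structure IsNormal (w : List S) : Prop where
  chain : w.IsChain M.Greedy
  bot_notMem : ⊥ ∉ w
  top_notMem : ⊤ ∉ w

/-- `π` respects the products of the germ. -/
structure IsRep {Γ : Type u} [Group Γ] (π : S → Γ) : Prop where
  map_top : π ⊤ = 1
  map_mul : ∀ x y, y ≤ M.comp x → π (M.mul x y) = π x * π y

variable {M}

theorem length_rightMulList (x : S) (u : List S) :
    (M.rightMulList x u).2.length = u.length := by
  induction u with
  | nil => rfl
  | cons a u ih => simp [rightMulList, ih]

/-- Every letter after the first is a remainder of a product whose left factor is a letter of `u`;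
only the first letter can become `⊤`. -/
theorem top_notMem_rightMulList (x : S) {u : List S} (hu : ⊤ ∉ u) :
    ⊤ ∉ (M.rightMulList x u).2 := by
  induction u with
  | nil => simp [rightMulList]
  | cons a u ih =>
    simp only [List.mem_cons, not_or] at hu
    simp only [rightMulList, List.mem_cons, not_or]
    exact ⟨(rest_ne_top (Ne.symm hu.1)).symm, ih hu.2⟩

theorem chain_rightMulList (x : S) {u : List S} (hu : u.IsChain M.Greedy) :
    ((M.rightMulList x u).1 :: (M.rightMulList x u).2).IsChain M.Greedy := by
  induction u with
  | nil => exact List.isChain_singleton _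
  | cons a u ih =>
    refine List.IsChain.cons_cons (greedy_head_rest _ _) ?_
    cases u with
    | nil => exact List.isChain_singleton _
    | cons b u =>
      rw [List.isChain_cons_cons] at hu
      exact List.IsChain.cons_cons hu.1.rest_rest (ih hu.2).tail

theorem leftMulList_tail_ne_top {a x : S} {u : List S} (ha : a ≠ ⊤)
    (hu : (a :: u).IsChain M.Greedy) (tu : ⊤ ∉ u) : ⊤ ∉ M.leftMulList (M.rest x a) u := by
  induction u generalizing a x with
  | nil => simpa [leftMulList] using (rest_ne_top' ha).symm
  | cons b u ih =>
    rw [List.isChain_cons_cons] at hu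
    simp only [List.mem_cons, not_or] at tu
    simp only [leftMulList, List.mem_cons, not_or]
    exact ⟨(head_rest_ne_top hu.1 ha).symm, ih (Ne.symm tu.1) hu.2 tu.2⟩

theorem chain_leftMulList (x : S) {u : List S} (hu : u.IsChain M.Greedy) :
    (M.leftMulList x u).IsChain M.Greedy := by
  induction u generalizing x with
  | nil => exact List.isChain_singleton _
  | cons a u ih =>
    cases u with
    | nil => exact List.IsChain.cons_cons (greedy_head_rest _ _) (List.isChain_singleton _)
    | cons b u =>
      rw [List.isChain_cons_cons] at hu
      exact List.IsChain.cons_cons hu.1.head_head (ih (M.rest x a) hu.2)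

/-! ### Evaluation in a group and fellow travelling -/

namespace IsRep

variable {Γ : Type u} [Group Γ] {π : S → Γ} (hπ : M.IsRep π)

include hπ

theorem map_bot : π ⊥ = 1 := by
  have h := hπ.map_mul ⊥ ⊥ bot_le
  rw [M.bot_mul] at h
  exact left_eq_mul.1 h

theorem map_comp (x : S) : π (M.comp x) = (π x)⁻¹ := by
  rw [eq_inv_iff_mul_eq_one, ← hπ.map_top, ← M.mul_comp (M.comp x), M.comp_comp,
    hπ.map_mul _ _ (by rw [M.comp_comp])]

theorem map_head (x y : S) : π (M.head x y) = π x * π (M.slide x y) :=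
  hπ.map_mul _ _ (slide_le_comp x y)

theorem map_slide_mul_rest (x y : S) : π (M.slide x y) * π (M.rest x y) = π y := by
  rw [← hπ.map_mul _ _ (rest_le x y), slide_mul_rest]

theorem map_head_mul_rest (x y : S) : π (M.head x y) * π (M.rest x y) = π x * π y := by
  rw [hπ.map_head, mul_assoc, hπ.map_slide_mul_rest]

theorem wordEval_rightMulList (x : S) (u : List S) :
    wordEval π ((M.rightMulList x u).1 :: (M.rightMulList x u).2) = wordEval π u * π x := by
  induction u with
  | nil => simp [rightMulList, wordEval]
  | cons a u ih =>
    simp only [wordEval_cons, rightMulList] at ih ⊢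
    rw [← mul_assoc, hπ.map_head_mul_rest, mul_assoc, ih, mul_assoc]

theorem wordEval_leftMulList (x : S) (u : List S) :
    wordEval π (M.leftMulList x u) = π x * wordEval π u := by
  induction u generalizing x with
  | nil => simp [leftMulList, wordEval]
  | cons a u ih =>
    rw [leftMulList, wordEval_cons, wordEval_cons, ih, ← mul_assoc, hπ.map_head_mul_rest,
      mul_assoc]

/-- After a prefix of `u` ending in `a`, the discrepancy is the part that `a` absorbs from the
renormalized remainder. -/
theorem wordAt_rightMulList (x : S) (u : List S) (t : ℕ) :
    ∃ y, wordAt π ((M.rightMulList x u).1 :: (M.rightMulList x u).2) t = wordAt π u t * π y := by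
  induction u generalizing t with
  | nil =>
    cases t with
    | zero => exact ⟨⊥, by simp [wordAt_zero, hπ.map_bot]⟩
    | succ t => exact ⟨x, by simp [rightMulList, wordAt_cons_succ, wordAt_nil]⟩
  | cons a u ih =>
    rcases t with _ | _ | t
    · exact ⟨⊥, by simp [wordAt_zero, hπ.map_bot]⟩
    · refine ⟨M.slide a (M.rightMulList x u).1, ?_⟩
      simp [rightMulList, wordAt_cons_succ, wordAt_zero, hπ.map_head]
    · obtain ⟨y, hy⟩ := ih (t + 1)
      refine ⟨y, ?_⟩
      rw [wordAt_cons_succ (w := u), mul_assoc, ← hy]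
      simp only [rightMulList, wordAt_cons_succ]
      rw [← mul_assoc, hπ.map_head_mul_rest, mul_assoc]

/-- The shifted comparison is for the case where a leading `⊤` is dropped; the discrepancy is then
the whole first letter of the renormalized remainder. -/
theorem wordAt_succ_rightMulList (x : S) (u : List S) (t : ℕ) :
    ∃ y, wordAt π ((M.rightMulList x u).1 :: (M.rightMulList x u).2) (t + 1) =
      wordAt π u t * π y := by
  induction u generalizing t with
  | nil => exact ⟨x, by simp [rightMulList, wordAt_cons_succ, wordAt_nil]⟩
  | cons a u ih =>
    rcases t with _ | t
    · exact ⟨_, by rw [wordAt_cons_succ, wordAt_zero, wordAt_zero, one_mul, mul_one]⟩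
    · obtain ⟨y, hy⟩ := ih t
      refine ⟨y, ?_⟩
      rw [wordAt_cons_succ (w := u), mul_assoc, ← hy]
      simp only [rightMulList, wordAt_cons_succ]
      rw [← mul_assoc, hπ.map_head_mul_rest, mul_assoc]

/-- Here `y` is what is still being carried after `t` letters. -/
theorem wordAt_leftMulList (x : S) (u : List S) (t : ℕ) :
    ∃ y, π x * wordAt π u t = wordAt π (M.leftMulList x u) t * π y := by
  induction u generalizing x t with
  | nil =>
    cases t with
    | zero => exact ⟨x, by simp [wordAt_zero]⟩
    | succ t => exact ⟨⊥, by simp [leftMulList, wordAt_cons_succ, wordAt_nil, hπ.map_bot]⟩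
  | cons a u ih =>
    cases t with
    | zero => exact ⟨x, by simp [wordAt_zero]⟩
    | succ t =>
      obtain ⟨y, hy⟩ := ih (M.rest x a) t
      refine ⟨y, ?_⟩
      rw [leftMulList, wordAt_cons_succ, wordAt_cons_succ, mul_assoc, ← hy, ← mul_assoc,
        ← mul_assoc, hπ.map_head_mul_rest]

theorem wordAt_succ_leftMulList (x : S) (u : List S) (t : ℕ) :
    ∃ y, wordAt π (M.leftMulList x u) (t + 1) = π x * wordAt π u t * π y := by
  induction u generalizing x t with
  | nil => exact ⟨⊥, by simp [leftMulList, wordAt_cons_succ, wordAt_nil, hπ.map_bot]⟩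
  | cons a u ih =>
    cases t with
    | zero => exact ⟨M.slide x a, by simp [leftMulList, wordAt_cons_succ, wordAt_zero, hπ.map_head]⟩
    | succ t =>
      obtain ⟨y, hy⟩ := ih (M.rest x a) t
      refine ⟨y, ?_⟩
      rw [leftMulList, wordAt_cons_succ, hy, wordAt_cons_succ, ← mul_assoc, ← mul_assoc,
        hπ.map_head_mul_rest, mul_assoc (π x)]

theorem wordAt_eq_one {w : List S} (h : ∀ a ∈ w, a = ⊥) (t : ℕ) : wordAt π w t = 1 := by
  apply List.prod_eq_one
  intro g hg
  obtain ⟨a, ha, rfl⟩ := List.mem_map.1 hg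
  rw [h a (List.mem_of_mem_take ha), hπ.map_bot]

/-- In a greedy word only `⊥` can follow `⊥`, so the trivial letters form a suffix, which can be cut
off. -/
theorem exists_prefix {w : List S} (hw : w.IsChain M.Greedy) :
    ∃ v, v <+: w ∧ ⊥ ∉ v ∧ ∀ t, wordAt π v t = wordAt π w t := by
  induction w with
  | nil => exact ⟨[], List.prefix_rfl, by simp, fun _ => rfl⟩
  | cons a w ih =>
    by_cases ha : a = ⊥
    · refine ⟨[], List.nil_prefix, by simp, fun t => ?_⟩
      rw [wordAt_nil, hπ.wordAt_eq_one]
      clear ih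
      induction w generalizing a with
      | nil => simpa using ha
      | cons b w ih =>
        rw [List.isChain_cons_cons] at hw
        have hb : b = ⊥ := Greedy.eq_bot (ha ▸ hw.1)
        intro c hc
        rcases List.mem_cons.1 hc with rfl | hc
        · exact ha
        · exact ih _ hw.2 hb c hc
    · obtain ⟨v, h1, h2, h3⟩ := ih hw.tail
      refine ⟨a :: v, List.cons_prefix_cons.2 ⟨rfl, h1⟩, ?_, fun t => ?_⟩
      · simpa [Ne.symm ha] using h2
      · cases t with
        | zero => rfl
        | succ t => rw [wordAt_cons_succ, wordAt_cons_succ, h3]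

theorem exists_isNormal_of_top_notMem {w : List S} (hw : w.IsChain M.Greedy) (tw : ⊤ ∉ w) :
    ∃ v, M.IsNormal v ∧ v.length ≤ w.length ∧ ∀ t, wordAt π v t = wordAt π w t := by
  obtain ⟨v, h1, h2, h3⟩ := hπ.exists_prefix hw
  exact ⟨v, ⟨hw.prefix h1, h2, fun h => tw (h1.subset h)⟩, h1.length_le, h3⟩

theorem exists_isNormal {c : S} {w : List S} (hw : (c :: w).IsChain M.Greedy) (tw : ⊤ ∉ w) :
    ∃ v, M.IsNormal v ∧ v.length ≤ w.length + 1 ∧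
      ((∀ t, wordAt π v t = wordAt π (c :: w) t) ∨
        ∀ t, wordAt π v t = wordAt π (c :: w) (t + 1)) := by
  by_cases hc : c = ⊤
  · obtain ⟨v, h1, h2, h3⟩ := hπ.exists_isNormal_of_top_notMem hw.tail tw
    refine ⟨v, h1, h2.trans (Nat.le_succ _), Or.inr fun t => ?_⟩
    rw [wordAt_cons_succ, hc, hπ.map_top, one_mul, h3]
    rfl
  · obtain ⟨v, h1, h2, h3⟩ := hπ.exists_isNormal_of_top_notMem hw (by simp [Ne.symm hc, tw])
    exact ⟨v, h1, h2, Or.inl h3⟩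

theorem exists_isNormal_mul_right {u : List S} (hu : M.IsNormal u) (x : S) :
    ∃ v, M.IsNormal v ∧ v.length ≤ u.length + 1 ∧ wordEval π v = wordEval π u * π x ∧
      ∀ t, ∃ y, wordAt π v t = wordAt π u t * π y := by
  obtain ⟨v, h1, h2, h3⟩ := hπ.exists_isNormal (chain_rightMulList x hu.chain)
    (top_notMem_rightMulList x hu.top_notMem)
  rw [length_rightMulList] at h2
  refine ⟨v, h1, h2, ?_, fun t => ?_⟩
  · rw [wordEval_eq_of_wordAt π h3, hπ.wordEval_rightMulList]
  · rcases h3 with h3 | h3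
    · rw [h3]
      exact hπ.wordAt_rightMulList x u t
    · rw [h3]
      exact hπ.wordAt_succ_rightMulList x u t

theorem exists_isNormal_mul_left {u : List S} (hu : M.IsNormal u) (x : S) :
    ∃ v, M.IsNormal v ∧ wordEval π v = π x * wordEval π u ∧
      ∀ t, ∃ y, wordAt π v t = π x * wordAt π u t * π y := by
  have key : ∃ c w, M.leftMulList x u = c :: w ∧ ⊤ ∉ w := by
    cases u with
    | nil => exact ⟨x, [], rfl, by simp⟩
    | cons a u =>
      have ht := hu.top_notMem
      simp only [List.mem_cons, not_or] at ht
      exact ⟨_, _, rfl, leftMulList_tail_ne_top (Ne.symm ht.1) hu.chain ht.2⟩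
  obtain ⟨c, w, e, tw⟩ := key
  obtain ⟨v, h1, -, h3⟩ := hπ.exists_isNormal (e ▸ chain_leftMulList x hu.chain) tw
  rw [← e] at h3
  refine ⟨v, h1, ?_, fun t => ?_⟩
  · rw [wordEval_eq_of_wordAt π h3, hπ.wordEval_leftMulList]
  · rcases h3 with h3 | h3
    · obtain ⟨y, hy⟩ := hπ.wordAt_leftMulList x u t
      -- The carried factor is on the other side of the equation; its complement represents its
      -- inverse.
      refine ⟨M.comp y, ?_⟩
      rw [h3, hπ.map_comp, hy, mul_inv_cancel_right]
    · rw [h3]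
      exact hπ.wordAt_succ_leftMulList x u t

end IsRep

end GarsideGerm

/-! ### Regular languages from finite memory -/

/-- Myhill–Nerode: among words that extend into `L`, the value of `f` determines the left quotient;
all other words have the empty one. -/
theorem Language.IsRegular.of_finite_memory {α β : Type*} {L : Language α} (f : List α → β)
    (hf : (f '' {x | ∃ y, x ++ y ∈ L}).Finite)
    (h : ∀ x x' y, f x = f x' → (∃ z, x' ++ z ∈ L) → x ++ y ∈ L → x' ++ y ∈ L) :
    L.IsRegular := by
  classical
  apply Language.IsRegular.of_finite_range_leftQuotient
  have hc : (L.leftQuotient '' {x | ∃ y, x ++ y ∈ L}).Finite := by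
    choose! s hs using fun (b : β) (hb : b ∈ f '' {x | ∃ y, x ++ y ∈ L}) => hb
    refine (hf.image (fun b => L.leftQuotient (s b))).subset ?_
    rintro _ ⟨x, hx, rfl⟩
    obtain ⟨h1, h2⟩ := hs (f x) ⟨x, hx, rfl⟩
    refine ⟨f x, ⟨x, hx, rfl⟩, ?_⟩
    ext y
    exact ⟨h _ _ y h2 hx, h _ _ y h2.symm h1⟩
  refine (hc.insert (∅ : Set (List α))).subset ?_
  rintro _ ⟨x, rfl⟩
  by_cases hx : ∃ y, x ++ y ∈ L
  · exact Or.inr ⟨x, hx, rfl⟩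
  · left
    ext y
    exact ⟨fun hy => hx ⟨y, hy⟩, fun hy => hy.elim⟩

theorem Language.isRegular_isChain {α : Type*} [Finite α] (R : α → α → Prop) :
    Language.IsRegular ({w | w.IsChain R} : Language α) := by
  refine Language.IsRegular.of_finite_memory List.getLast? (Set.toFinite _) ?_
  rintro x x' y e ⟨z, hz⟩ hy
  have hz' := (List.isChain_append.1 hz).1
  obtain ⟨-, h2, h3⟩ := List.isChain_append.1 hy
  exact List.isChain_append.2 ⟨hz', h2, e ▸ h3⟩

/-! ### Padded pairs -/

section PadPair

variable {A : Type u}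

/-- The relation between consecutive letters of a padded pair of words. -/
def PadRel (a b : Option A × Option A) : Prop :=
  (a.1 = none → b.1 = none) ∧ (a.2 = none → b.2 = none)

/-- The words that are the padded pairs of some words. -/
def IsPadded (z : List (Option A × Option A)) : Prop :=
  z.IsChain PadRel ∧ (none, none) ∉ z

theorem filterMap_fst_take_padPair (u v : List A) (t : ℕ) :
    ((padPair u v).take t).filterMap Prod.fst = u.take t := by
  induction u generalizing v t with
  | nil => simp [padPair, ← List.map_take, List.filterMap_map]
  | cons a u ih =>
    cases t with
    | zero => simp
    | succ t =>
      cases v with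
      | nil => simp [padPair, ← List.map_take, List.filterMap_map]
      | cons b v => simp [padPair, ih]

theorem filterMap_snd_take_padPair (u v : List A) (t : ℕ) :
    ((padPair u v).take t).filterMap Prod.snd = v.take t := by
  induction u generalizing v t with
  | nil => simp [padPair, ← List.map_take, List.filterMap_map]
  | cons a u ih =>
    cases t with
    | zero => simp
    | succ t =>
      cases v with
      | nil => simp [padPair, ← List.map_take, List.filterMap_map]
      | cons b v => simp [padPair, ih]

theorem filterMap_fst_padPair (u v : List A) : (padPair u v).filterMap Prod.fst = u := by
  have h := filterMap_fst_take_padPair u v (max (padPair u v).length u.length)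
  rwa [List.take_of_length_le (le_max_left _ _), List.take_of_length_le (le_max_right _ _)] at h

theorem filterMap_snd_padPair (u v : List A) : (padPair u v).filterMap Prod.snd = v := by
  have h := filterMap_snd_take_padPair u v (max (padPair u v).length v.length)
  rwa [List.take_of_length_le (le_max_left _ _), List.take_of_length_le (le_max_right _ _)] at h

theorem isPadded_padPair (u v : List A) : IsPadded (padPair u v) := by
  induction u generalizing v with
  | nil =>
    refine ⟨?_, by simp [padPair]⟩
    rw [padPair, List.isChain_map]
    exact (List.pairwise_iff_forall_sublist.2 fun _ => by simp [PadRel]).isChain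
  | cons a u ih =>
    cases v with
    | nil =>
      refine ⟨?_, by simp [padPair]⟩
      change List.IsChain PadRel ((a :: u).map fun a => (some a, none))
      rw [List.isChain_map]
      exact (List.pairwise_iff_forall_sublist.2 fun _ => by simp [PadRel]).isChain
    | cons b v =>
      refine ⟨(List.isChain_cons).2 ⟨fun _ _ => by simp [PadRel], (ih v).1⟩, ?_⟩
      simpa [padPair] using (ih v).2

theorem IsPadded.padPair_eq {z : List (Option A × Option A)} (hz : IsPadded z) :
    padPair (z.filterMap Prod.fst) (z.filterMap Prod.snd) = z := by
  induction z with
  | nil => rfl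
  | cons c z ih' =>
    have ih := ih' ⟨hz.1.tail, fun h => hz.2 (List.mem_cons_of_mem _ h)⟩
    obtain ⟨h1, h2⟩ := hz
    -- Once a component is padded it stays padded, so nothing more is read from it.
    have hp : ∀ (p : Option A × Option A → Option A), (∀ a b, PadRel a b → p a = none → p b = none) →
        p c = none → z.filterMap p = [] := by
      intro p hp hc
      clear ih h2 ih'
      rw [List.filterMap_eq_nil_iff]
      induction z generalizing c with
      | nil => simp
      | cons d z ihz =>
        rw [List.isChain_cons_cons] at h1
        have hd := hp _ _ h1.1 hc
        intro a ha
        rcases List.mem_cons.1 ha with rfl | ha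
        · exact hd
        · exact ihz _ h1.2 hd a ha
    rcases c with ⟨_ | a, _ | b⟩
    · simp at h2
    · have e := hp Prod.fst (fun _ _ h => h.1) rfl
      rw [e] at ih
      simp only [List.filterMap_cons, e]
      rw [padPair] at ih ⊢
      rw [List.map_cons, ih]
    · have e := hp Prod.snd (fun _ _ h => h.2) rfl
      rw [e] at ih
      simp only [List.filterMap_cons, e, padPair]
      congr 1
      cases hz : z.filterMap Prod.fst with
      | nil => rw [hz] at ih; exact ih
      | cons a' u => rw [hz] at ih; exact ih
    · simp only [List.filterMap_cons, padPair, ih]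

end PadPair

/-! ### Multiplier languages of fellow travelling words -/

section Multiplier

variable {A Γ : Type u} [Group Γ] {π : A → Γ} {L : Language A}

theorem mem_multiplierLanguage_iff {g h : Γ} {z : List (Option A × Option A)} :
    z ∈ multiplierLanguage π L g h ↔ IsPadded z ∧ z.filterMap Prod.fst ∈ L ∧
      z.filterMap Prod.snd ∈ L ∧
        g * wordEval π (z.filterMap Prod.fst) * h = wordEval π (z.filterMap Prod.snd) := by
  constructor
  · rintro ⟨u, hu, v, hv, e, rfl⟩
    rw [filterMap_fst_padPair, filterMap_snd_padPair]
    exact ⟨isPadded_padPair u v, hu, hv, e⟩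
  · rintro ⟨hz, hu, hv, e⟩
    exact ⟨_, hu, _, hv, e, hz.padPair_eq.symm⟩

/-- If `L` is regular and the words `w₁`, `w₂` of `L` with `g w₁ h = w₂` stay close to each other,
then the padded pairs of such words form a regular language. -/
theorem isRegular_multiplierLanguage [Finite A] (hL : L.IsRegular) {g h : Γ} {F : Set Γ}
    (hF : F.Finite)
    (hw : ∀ w₁ ∈ L, ∀ w₂ ∈ L, g * wordEval π w₁ * h = wordEval π w₂ →
      ∀ t, (g * wordAt π w₁ t)⁻¹ * wordAt π w₂ t ∈ F) :
    (multiplierLanguage π L g h).IsRegular := by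
  have hL' := hL.finite_range_leftQuotient
  -- The memory holds the state of each component, the group element between the two prefixes, and
  -- the last letter, which controls the padding.
  refine Language.IsRegular.of_finite_memory
    (fun x => (L.leftQuotient (x.filterMap Prod.fst), L.leftQuotient (x.filterMap Prod.snd),
      (g * wordEval π (x.filterMap Prod.fst))⁻¹ * wordEval π (x.filterMap Prod.snd),
      x.getLast?)) ?_ ?_
  · refine (hL'.prod (hL'.prod (hF.prod Set.finite_univ))).subset ?_
    rintro _ ⟨x, ⟨y, u, hu, v, hv, e, hxy⟩, rfl⟩
    refine ⟨⟨_, rfl⟩, ⟨_, rfl⟩, ?_, Set.mem_univ _⟩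
    have hx : (padPair u v).take x.length = x := by rw [← hxy, List.take_left]
    have := hw u hu v hv e x.length
    rwa [wordAt, wordAt, ← filterMap_fst_take_padPair u v, ← filterMap_snd_take_padPair u v,
      hx] at this
  · rintro x x' y e ⟨z, hz⟩ hy
    simp only [Prod.mk.injEq] at e
    obtain ⟨e1, e2, e3, e4⟩ := e
    rw [mem_multiplierLanguage_iff] at hz hy ⊢
    simp only [List.filterMap_append, wordEval_append] at hz hy ⊢
    obtain ⟨⟨hy1, hy2⟩, hy3, hy4, hy5⟩ := hy
    obtain ⟨⟨hz1, hz2⟩, -⟩ := hz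
    rw [List.isChain_append] at hy1 hz1
    simp only [List.mem_append, not_or] at hy2 hz2
    refine ⟨⟨List.isChain_append.2 ⟨hz1.1, hy1.2.1, e4 ▸ hy1.2.2⟩, ?_⟩, ?_, ?_, ?_⟩
    · rw [List.mem_append, not_or]
      exact ⟨hz2.1, hy2.2⟩
    · change _ ∈ L.leftQuotient _
      rw [← e1]
      exact hy3
    · change _ ∈ L.leftQuotient _
      rw [← e2]
      exact hy4
    -- Solved for the suffix, the multiplier equation involves the prefix only through the
    -- remembered group element.
    · have key : wordEval π (y.filterMap Prod.fst) * h = (g * wordEval π (x.filterMap Prod.fst))⁻¹ *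
          wordEval π (x.filterMap Prod.snd) * wordEval π (y.filterMap Prod.snd) := by
        rw [mul_assoc, ← hy5]
        group
      rw [e3, mul_assoc, eq_inv_mul_iff_mul_eq] at key
      rw [← key]
      group

end Multiplier

/-! ### The germ of a triangle presentation -/

namespace ProjGeometry

variable {P : Type u} (G : ProjGeometry P)

/-- The subspaces of `G`, ordered by reverse inclusion. -/
def Simple : Type u := (G.Subspace)ᵒᵈ

namespace Simple

instance : PartialOrder (Simple G) := inferInstanceAs (PartialOrder (G.Subspace)ᵒᵈ)

/-- The subspace spanned by a set of points. -/
def span (X : Set P) : G.Subspace :=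
  ⟨{p | ∀ Y : G.Subspace, X ⊆ Y.1 → p ∈ Y.1}, fun p hp q hq hpq l hl hpl hql _ hr Y hY =>
    Y.2 p (hp Y hY) q (hq Y hY) hpq l hl hpl hql hr⟩

/-- In the reversed order the meet is the span, so greediness becomes the spanning condition
defining `L`. -/
instance : SemilatticeInf (Simple G) where
  inf x y := OrderDual.toDual (span G ((OrderDual.ofDual x).1 ∪ (OrderDual.ofDual y).1))
  inf_le_left _ _ := fun _ hp _ hY => hY (Or.inl hp)
  inf_le_right _ _ := fun _ hp _ hY => hY (Or.inr hp)
  le_inf a _ _ hab hac := fun _ hp => hp (OrderDual.ofDual a) (Set.union_subset hab hac)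

instance : BoundedOrder (Simple G) where
  top := OrderDual.toDual ⟨∅, fun _ hp => hp.elim⟩
  le_top _ := fun _ hp => hp.elim
  bot := OrderDual.toDual G.whole
  bot_le _ := fun _ _ => trivial

variable {G}

/-- An element of `Π` as a subspace. -/
def ofElem (x : G.Elem) : Simple G := OrderDual.toDual x.1

theorem ofElem_le {x y : G.Elem} : ofElem x ≤ ofElem y ↔ y ≤ x := Iff.rfl

theorem ofElem_injective : Function.Injective (ofElem (G := G)) := fun _ _ h => Subtype.ext h

theorem ofElem_ne_bot (x : G.Elem) : ofElem x ≠ ⊥ :=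
  fun h => x.2.2 (congrArg Subtype.val (show x.1 = G.whole from h))

theorem ofElem_ne_top (x : G.Elem) : ofElem x ≠ ⊤ := by
  intro h
  obtain ⟨p, hp⟩ := x.2.1
  have h' : x.1.1 = ∅ := congrArg Subtype.val (show x.1 = ⟨∅, fun _ hp => hp.elim⟩ from h)
  rw [h'] at hp
  exact hp

theorem eq_bot_or_eq_top_or (s : Simple G) : s = ⊥ ∨ s = ⊤ ∨ ∃ x, s = ofElem x := by
  by_cases h1 : (OrderDual.ofDual s).1 = Set.univ
  · exact Or.inl (Subtype.ext h1)
  · by_cases h2 : (OrderDual.ofDual s).1 = ∅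
    · exact Or.inr (Or.inl (Subtype.ext h2))
    · exact Or.inr (Or.inr ⟨⟨OrderDual.ofDual s, Set.nonempty_iff_ne_empty.2 h2, h1⟩, rfl⟩)

instance [Nonempty P] : Nontrivial (Simple G) :=
  ⟨⊥, ⊤, fun h => Set.univ_nonempty.ne_empty
    (congrArg Subtype.val (show G.whole = ⟨∅, fun _ hp => hp.elim⟩ from h))⟩

open Classical in
/-- Extends a function on `Π` to all subspaces. -/
noncomputable def extend {β : Type*} (f : G.Elem → β) (b t : β) (s : Simple G) : β :=
  if h : ∃ x, s = ofElem x then f h.choose else if s = ⊥ then b else t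

theorem extend_ofElem {β : Type*} (f : G.Elem → β) (b t : β) (x : G.Elem) :
    extend f b t (ofElem x) = f x := by
  have h : ∃ y, ofElem x = ofElem y := ⟨x, rfl⟩
  rw [extend, dif_pos h, ← ofElem_injective h.choose_spec]

theorem extend_bot {β : Type*} (f : G.Elem → β) (b t : β) : extend f b t ⊥ = b := by
  rw [extend, dif_neg, if_pos rfl]
  rintro ⟨x, hx⟩
  exact ofElem_ne_bot x hx.symm

theorem extend_top [Nonempty P] {β : Type*} (f : G.Elem → β) (b t : β) :
    extend f b t ⊤ = t := by
  rw [extend, dif_neg, if_neg top_ne_bot]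
  rintro ⟨x, hx⟩
  exact ofElem_ne_top x hx.symm

/-- The complement map on all subspaces. -/
noncomputable def comp (lam : G.Elem → G.Elem) : Simple G → Simple G :=
  extend (fun x => ofElem (lam x)) ⊤ ⊥

open Classical in
/-- The partial product of subspaces that is given by the triangles `(u, v, w)`, for which it maps
`u, v` to `lam w`. -/
noncomputable def mul (lam : G.Elem → G.Elem) (T : Set (G.Elem × G.Elem × G.Elem))
    (s t : Simple G) : Simple G :=
  extend (fun u => extend (fun v =>
    if h : ∃ w, (u, v, w) ∈ T then ofElem (lam h.choose) else ⊤) s ⊤ t) t ⊤ s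

end Simple

end ProjGeometry

/-! ### Triangles as products of subspaces -/

namespace IsTrianglePresentation

open ProjGeometry ProjGeometry.Simple

variable {P : Type u} {G : ProjGeometry P} {n : ℕ} {lam : G.Elem → G.Elem}
  {T : Set (G.Elem × G.Elem × G.Elem)}

/-- The triangles whose dimensions add up to `2 (n + 1)`. -/
def Big (n : ℕ) (T : Set (G.Elem × G.Elem × G.Elem)) (u v w : G.Elem) : Prop :=
  (u, v, w) ∈ T ∧ u.dim + v.dim + w.dim = 2 * (n + 1)

/-- Finite dimension makes all heights finite, so strict monotonicity survives `toNat`. -/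
theorem dim_lt_dim (hG : G.HasDimension n) {x y : G.Elem} (h : x < y) : x.dim < y.dim := by
  have hfin : ∀ z : G.Elem, Order.height z.1 ≠ ⊤ := by
    intro z hz
    have h1 : Order.height z.1 ≤ Order.height G.whole :=
      Order.height_mono (show z.1 ≤ G.whole from Set.subset_univ _)
    rw [hz, hG, top_le_iff] at h1
    exact ENat.natCast_ne_top (n + 1) (by exact_mod_cast h1)
  have h1 := Order.height_strictMono (show x.1 < y.1 from h) (lt_top_iff_ne_top.2 (hfin x))
  rw [Elem.dim, Elem.dim]
  rw [← ENat.natCast_toNat (hfin x), ← ENat.natCast_toNat (hfin y)] at h1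
  exact_mod_cast h1

theorem nonempty_of_hasDimension (hG : G.HasDimension n) : Nonempty P := by
  by_contra h
  rw [not_nonempty_iff] at h
  have h0 : Order.height G.whole = 0 :=
    Order.height_eq_zero.2 fun _ _ p => isEmptyElim (α := P) p
  rw [HasDimension, h0] at hG
  exact absurd hG.symm (by exact_mod_cast Nat.succ_ne_zero n)

variable (hT : IsTrianglePresentation G n lam T) (hG : G.HasDimension n)

include hT

theorem dim_le (x : G.Elem) : x.dim ≤ n + 1 := by
  have := hT.dim_lam x
  omega

theorem Big.rotate {u v w : G.Elem} (h : Big n T u v w) : Big n T v w u := by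
  refine ⟨hT.axB _ _ _ h.1, ?_⟩
  have := h.2
  omega

theorem big_of_mem_halfTriples {u v w : G.Elem} (h : (u, v, w) ∈ halfTriples n T) :
    Big n T (lam w) (lam v) (lam u) := by
  refine ⟨hT.axD _ _ _ h.1, ?_⟩
  have h0 := h.2
  have h1 := hT.dim_lam u
  have h2 := hT.dim_lam v
  have h3 := hT.dim_lam w
  simp only at h0
  omega

theorem Big.mem_halfTriples {u v w : G.Elem} (h : Big n T u v w) :
    (lam w, lam v, lam u) ∈ halfTriples n T := by
  refine ⟨hT.axD _ _ _ h.1, ?_⟩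
  have h0 := h.2
  have h1 := hT.dim_lam u
  have h2 := hT.dim_lam v
  have h3 := hT.dim_lam w
  simp only
  omega

/-- Axiom (F) transported by (D). The hypotheses say `x y = λ(u)` and `λ(u) x' = λ(y')`; the
conclusion says `y x' = w` and `x w = λ(y')`. -/
theorem Big.assoc {x y u x' y' : G.Elem} (h : Big n T x y u) (h' : Big n T x' y' (lam u)) :
    ∃ w, Big n T y' x w ∧ Big n T y x' (lam w) := by
  have h1 := Big.mem_halfTriples hT (h.rotate hT |>.rotate hT)
  have h2 := Big.mem_halfTriples hT (h'.rotate hT |>.rotate hT)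
  obtain ⟨w, h3, h4⟩ := hT.axF _ _ _ _ _ h1 h2
  have h3 := big_of_mem_halfTriples hT h3
  have h4 := big_of_mem_halfTriples hT h4
  simp only [hT.involutive _] at h3 h4
  exact ⟨w, h4.rotate hT, h3.rotate hT⟩

include hG

/-- Incidence in the other direction would give `dim u + dim v < n + 1`, too little for a dimension
sum of `2 (n + 1)`. -/
theorem Big.lt {u v w : G.Elem} (h : Big n T u v w) : lam u < v := by
  obtain ⟨h1, h2⟩ := (hT.axA u v).1 ⟨w, h.1⟩
  rcases h2 with h2 | h2
  · exact lt_of_le_of_ne h2 h1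
  · exfalso
    have := dim_lt_dim hG (lt_of_le_of_ne h2 h1.symm)
    have := hT.dim_lam u
    have := dim_le hT w
    have := h.2
    omega

theorem exists_big {u v : G.Elem} (h : lam u < v) : ∃ w, Big n T u v w := by
  obtain ⟨w, hw⟩ := (hT.axA u v).2 ⟨h.ne, Or.inl h.le⟩
  refine ⟨w, hw, ?_⟩
  have := dim_lt_dim hG h
  have := hT.dim_lam u
  have := hT.axE _ _ _ hw
  omega

omit hG in
theorem mul_ofElem {u v w : G.Elem} (h : (u, v, w) ∈ T) :
    Simple.mul lam T (ofElem u) (ofElem v) = ofElem (lam w) := by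
  have h' : ∃ w, (u, v, w) ∈ T := ⟨w, h⟩
  rw [Simple.mul, extend_ofElem, extend_ofElem, dif_pos h', hT.axC _ _ _ _ h'.choose_spec h]

omit hG in
theorem mul_ofElem_lam (u : G.Elem) :
    Simple.mul lam T (ofElem u) (ofElem (lam u)) = ⊤ := by
  rw [Simple.mul, extend_ofElem, extend_ofElem, dif_neg]
  exact fun h => ((hT.axA _ _).1 h).1 rfl

omit hT hG in
theorem bot_mul (s : Simple G) : Simple.mul lam T ⊥ s = s := extend_bot _ _ _

omit hT hG in
theorem mul_bot [Nonempty P] (s : Simple G) : Simple.mul lam T s ⊥ = s := by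
  rcases eq_bot_or_eq_top_or s with rfl | rfl | ⟨x, rfl⟩
  · exact bot_mul _
  · exact extend_top _ _ _
  · rw [Simple.mul, extend_ofElem, extend_bot]

omit hT hG in
theorem comp_ofElem (x : G.Elem) : Simple.comp lam (ofElem x) = ofElem (lam x) :=
  extend_ofElem _ _ _ _

omit hT hG in
theorem comp_bot : Simple.comp lam ⊥ = ⊤ := extend_bot _ _ _

omit hT hG in
theorem comp_top [Nonempty P] : Simple.comp lam ⊤ = ⊥ := extend_top _ _ _

theorem mul_cases [Nonempty P] {u : G.Elem} {s : Simple G} (h : s ≤ Simple.comp lam (ofElem u)) :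
    s = ⊥ ∨ s = ofElem (lam u) ∨ ∃ v w, s = ofElem v ∧ Big n T u v w ∧ lam w < u ∧
      Simple.mul lam T (ofElem u) s = ofElem (lam w) := by
  rw [comp_ofElem] at h
  rcases eq_bot_or_eq_top_or s with rfl | rfl | ⟨v, rfl⟩
  · exact Or.inl rfl
  · exact absurd (top_le_iff.1 h) (ofElem_ne_top _)
  · rw [ofElem_le] at h
    rcases eq_or_lt_of_le h with rfl | h
    · exact Or.inr (Or.inl rfl)
    · obtain ⟨w, hw⟩ := exists_big hT hG h
      exact Or.inr (Or.inr ⟨v, w, rfl, hw, Big.lt hT hG (hw.rotate hT |>.rotate hT),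
        mul_ofElem hT hw.1⟩)

/-- The Garside germ of a triangle presentation. -/
noncomputable def germ : GarsideGerm (Simple G) :=
  haveI := nonempty_of_hasDimension hG
  { comp := Simple.comp lam
    mul := Simple.mul lam T
    comp_comp := fun x => by
      rcases eq_bot_or_eq_top_or x with rfl | rfl | ⟨x, rfl⟩
      · rw [comp_bot, comp_top]
      · rw [comp_top, comp_bot]
      · rw [comp_ofElem, comp_ofElem, hT.involutive]
    bot_mul := bot_mul
    mul_bot := mul_bot
    mul_comp := fun x => by
      rcases eq_bot_or_eq_top_or x with rfl | rfl | ⟨x, rfl⟩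
      · rw [comp_bot, bot_mul]
      · rw [comp_top, mul_bot]
      · rw [comp_ofElem, mul_ofElem_lam hT]
    le_mul := fun x y h => by
      rcases eq_bot_or_eq_top_or x with rfl | rfl | ⟨u, rfl⟩
      · exact bot_le
      · rw [comp_top, le_bot_iff] at h
        rw [h, mul_bot]
      · rcases mul_cases hT hG h with rfl | rfl | ⟨v, w, rfl, -, hlt, e⟩
        · rw [mul_bot]
        · rw [mul_ofElem_lam hT]
          exact le_top
        · rw [e]
          exact hlt.le
    exists_mul_eq := fun x z h => by
      rcases eq_bot_or_eq_top_or x with rfl | rfl | ⟨u, rfl⟩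
      · exact ⟨z, by rw [comp_bot]; exact le_top, bot_mul z⟩
      · exact ⟨⊥, bot_le, by rw [mul_bot, top_le_iff.1 h]⟩
      · rcases eq_bot_or_eq_top_or z with rfl | rfl | ⟨z, rfl⟩
        · exact absurd (le_bot_iff.1 h) (ofElem_ne_bot u)
        · exact ⟨ofElem (lam u), by rw [comp_ofElem], mul_ofElem_lam hT u⟩
        · rcases eq_or_lt_of_le (ofElem_le.1 h) with rfl | hlt
          · exact ⟨⊥, bot_le, mul_bot _⟩
          -- The triangle `(λ(z), u, v)`, rotated to `(u, v, λ(z))`, says that `u v = z`.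
          · obtain ⟨v, hv⟩ := exists_big hT hG (u := lam z) (v := u) (by rwa [hT.involutive])
            have hv' := hv.rotate hT
            refine ⟨ofElem v, ?_, ?_⟩
            · rw [comp_ofElem]
              exact (Big.lt hT hG hv').le
            · rw [mul_ofElem hT hv'.1, hT.involutive]
    mul_left_cancel := fun x y z hy hz e => by
      rcases eq_bot_or_eq_top_or x with rfl | rfl | ⟨u, rfl⟩
      · rwa [bot_mul, bot_mul] at e
      · rw [comp_top, le_bot_iff] at hy hz
        rw [hy, hz]
      · rcases mul_cases hT hG hy with rfl | rfl | ⟨v, w, rfl, h1, hlt, e1⟩ <;>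
          rcases mul_cases hT hG hz with rfl | rfl | ⟨v', w', rfl, h1', hlt', e1'⟩
        · rfl
        · rw [mul_bot, mul_ofElem_lam hT] at e
          exact absurd e (ofElem_ne_top u)
        · rw [mul_bot, e1'] at e
          exact absurd (ofElem_injective e) hlt'.ne'
        · rw [mul_bot, mul_ofElem_lam hT] at e
          exact absurd e.symm (ofElem_ne_top u)
        · rfl
        · rw [mul_ofElem_lam hT, e1'] at e
          exact absurd e.symm (ofElem_ne_top _)
        · rw [mul_bot, e1] at e
          exact absurd (ofElem_injective e) hlt.ne
        · rw [mul_ofElem_lam hT, e1] at e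
          exact absurd e (ofElem_ne_top _)
        · rw [e1, e1'] at e
          have hw : w = w' := hT.involutive.injective (ofElem_injective e)
          subst hw
          -- Rotated so that `w, u` come first, the two triangles must have the same third entry.
          rw [hT.axC _ _ _ _ (h1.rotate hT |>.rotate hT).1 (h1'.rotate hT |>.rotate hT).1]
    assoc := fun x y z hy hz => by
      rcases eq_bot_or_eq_top_or x with rfl | rfl | ⟨u, rfl⟩
      · rw [bot_mul] at hz
        rw [bot_mul, bot_mul, comp_bot]
        exact ⟨hz, le_top, rfl⟩
      · rw [comp_top, le_bot_iff] at hy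
        subst hy
        rw [mul_bot] at hz
        rw [mul_bot, bot_mul, comp_bot]
        exact ⟨le_top, hz, rfl⟩
      · rcases mul_cases hT hG hy with rfl | rfl | ⟨v, w, rfl, h1, hlt, e1⟩
        · rw [mul_bot] at hz
          rw [mul_bot, bot_mul, comp_bot]
          exact ⟨le_top, hz, rfl⟩
        · rw [mul_ofElem_lam hT, comp_top, le_bot_iff] at hz
          subst hz
          rw [mul_bot, mul_bot]
          exact ⟨bot_le, hy, rfl⟩
        · rw [e1] at hz ⊢
          rcases mul_cases hT hG hz with rfl | rfl | ⟨z, w', rfl, h2, -, e2⟩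
          · rw [mul_bot, mul_bot, e1]
            exact ⟨bot_le, hy, rfl⟩
          -- Here `z = λ(λ(w)) = w`, and the rotated triangle gives `v w = λ(u)`, so both
          -- bracketings equal `⊤`.
          · have h3 := h1.rotate hT
            rw [mul_ofElem_lam hT, hT.involutive, mul_ofElem hT h3.1, mul_ofElem_lam hT,
              comp_ofElem, comp_ofElem]
            exact ⟨(Big.lt hT hG h3).le, le_rfl, rfl⟩
          · obtain ⟨k, h3, h4⟩ := Big.assoc hT h1 (h2.rotate hT)
            have h5 := h3.rotate hT
            rw [e2, mul_ofElem hT h4.1, hT.involutive, mul_ofElem hT h5.1, comp_ofElem,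
              comp_ofElem]
            exact ⟨(Big.lt hT hG h4).le, (Big.lt hT hG h5).le, rfl⟩ }

theorem germ_comp_ofElem (x : G.Elem) : (germ hT hG).comp (ofElem x) = ofElem (lam x) :=
  comp_ofElem x

theorem greedy_ofElem {u v : G.Elem} :
    (germ hT hG).Greedy (ofElem u) (ofElem v) ↔ (lam u).Spans v := by
  rw [GarsideGerm.Greedy, germ_comp_ofElem hT hG]
  constructor
  · rintro h ⟨z, h1, h2⟩
    have : ofElem z ≤ ofElem (lam u) ⊓ ofElem v := le_inf h1 h2
    rw [h, le_bot_iff] at this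
    exact ofElem_ne_bot z this
  · intro h
    rcases eq_bot_or_eq_top_or (ofElem (lam u) ⊓ ofElem v) with e | e | ⟨z, e⟩
    · exact e
    · have : (⊤ : Simple G) ≤ ofElem v := e ▸ inf_le_right
      exact absurd (top_le_iff.1 this) (ofElem_ne_top v)
    · exact absurd ⟨z, ofElem_le.1 (e ▸ inf_le_left), ofElem_le.1 (e ▸ inf_le_right)⟩ h

theorem isNormal_map_ofElem {w : List G.Elem} :
    (germ hT hG).IsNormal (w.map ofElem) ↔ w ∈ normalForms lam := by
  have key : (w.map ofElem).IsChain (germ hT hG).Greedy ↔ w ∈ normalForms lam := by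
    rw [List.isChain_map]
    simp only [greedy_ofElem hT hG]
    rfl
  refine ⟨fun h => key.1 h.chain, fun h => ⟨key.2 h, ?_, ?_⟩⟩
  · rw [List.mem_map]
    rintro ⟨x, -, hx⟩
    exact ofElem_ne_bot x hx
  · rw [List.mem_map]
    rintro ⟨x, -, hx⟩
    exact ofElem_ne_top x hx

theorem exists_map_ofElem {v : List (Simple G)} (hv : (germ hT hG).IsNormal v) :
    ∃ w : List G.Elem, w ∈ normalForms lam ∧ w.map ofElem = v := by
  have h : v ∈ Set.range (List.map (ofElem (G := G))) := by
    rw [Set.range_list_map]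
    intro s hs
    rcases eq_bot_or_eq_top_or s with rfl | rfl | ⟨x, rfl⟩
    · exact absurd hs hv.bot_notMem
    · exact absurd hs hv.top_notMem
    · exact ⟨x, rfl⟩
  obtain ⟨w, rfl⟩ := h
  exact ⟨w, (isNormal_map_ofElem hT hG).1 hv, rfl⟩

omit hG in
-- A triangle of the smaller dimension sum is dual to one of the larger, so its relation is the
-- inverse of one already known.
theorem prod_eq_one_of_mem {H : Type*} [Group H] {f : G.Elem → H}
    (h1 : ∀ x, f (lam x) * f x = 1)
    (h2 : ∀ u v w, Big n T u v w → f u * f v = f (lam w)) {u v w : G.Elem} (h : (u, v, w) ∈ T) :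
    f u * f v * f w = 1 := by
  rcases hT.axE _ _ _ h with hd | hd
  · have h3 := h2 _ _ _ (big_of_mem_halfTriples hT ⟨h, hd⟩)
    have hi : ∀ x, f (lam x) = (f x)⁻¹ := fun x => eq_inv_of_mul_eq_one_left (h1 x)
    simp only [hi, inv_inv] at h3
    rw [← h3]
    group
  · rw [h2 _ _ _ ⟨h, hd⟩, h1]

end IsTrianglePresentation

namespace IsTrianglePresentation

open ProjGeometry ProjGeometry.Simple

variable {P : Type u} {G : ProjGeometry P} {n : ℕ} {lam : G.Elem → G.Elem}
  {T : Set (G.Elem × G.Elem × G.Elem)}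

/-! ### The group of a triangle presentation -/

theorem triangleGen_lam_mul (v : G.Elem) :
    triangleGen lam T (lam v) * triangleGen lam T v = 1 :=
  PresentedGroup.one_of_mem (rels := triangleRels lam T) (Or.inl ⟨v, rfl⟩)

theorem triangleGen_lam (v : G.Elem) : triangleGen lam T (lam v) = (triangleGen lam T v)⁻¹ :=
  eq_inv_of_mul_eq_one_left (triangleGen_lam_mul v)

theorem triangleGen_mul {u v w : G.Elem} (h : (u, v, w) ∈ T) :
    triangleGen lam T u * triangleGen lam T v = triangleGen lam T (lam w) := by
  have : triangleGen lam T u * triangleGen lam T v * triangleGen lam T w = 1 :=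
    PresentedGroup.one_of_mem (rels := triangleRels lam T) (Or.inr ⟨u, v, w, h, rfl⟩)
  rw [eq_inv_of_mul_eq_one_left this, triangleGen_lam]

/-- The element of `Γ_𝒯` that belongs to a subspace. -/
noncomputable def simpleGen (lam : G.Elem → G.Elem) (T : Set (G.Elem × G.Elem × G.Elem)) :
    Simple G → TriangleGroup lam T :=
  extend (triangleGen lam T) 1 1

theorem simpleGen_ofElem (x : G.Elem) : simpleGen lam T (ofElem x) = triangleGen lam T x :=
  extend_ofElem _ _ _ _

theorem simpleGen_mem (s : Simple G) :
    simpleGen lam T s = 1 ∨ ∃ x, simpleGen lam T s = triangleGen lam T x := by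
  rw [simpleGen, extend]
  split_ifs with h
  · exact Or.inr ⟨_, rfl⟩
  · exact Or.inl rfl
  · exact Or.inl rfl

theorem wordEval_map_ofElem (w : List G.Elem) :
    wordEval (simpleGen lam T) (w.map ofElem) = wordEval (triangleGen lam T) w := by
  rw [wordEval, List.map_map, wordEval]
  congr 2
  funext x
  exact simpleGen_ofElem x

theorem wordAt_map_ofElem (w : List G.Elem) (t : ℕ) :
    wordAt (simpleGen lam T) (w.map ofElem) t = wordAt (triangleGen lam T) w t := by
  rw [wordAt, ← List.map_take, wordEval_map_ofElem, wordAt]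

variable (hT : IsTrianglePresentation G n lam T) (hG : G.HasDimension n)

include hT hG

theorem isRep_simpleGen : (germ hT hG).IsRep (simpleGen lam T) := by
  have := nonempty_of_hasDimension hG
  refine ⟨extend_top _ _ _, fun x y hy => ?_⟩
  have hb : simpleGen lam T ⊥ = 1 := extend_bot _ _ _
  have ht : simpleGen lam T ⊤ = 1 := extend_top _ _ _
  rcases eq_bot_or_eq_top_or x with rfl | rfl | ⟨u, rfl⟩
  · rw [(germ hT hG).bot_mul, hb, one_mul]
  · rw [(germ hT hG).comp_top, le_bot_iff] at hy
    rw [hy, (germ hT hG).mul_bot, hb, mul_one]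
  · rcases mul_cases hT hG hy with rfl | rfl | ⟨v, w, rfl, h1, -, e⟩
    · rw [(germ hT hG).mul_bot, hb, mul_one]
    · rw [← germ_comp_ofElem hT hG, (germ hT hG).mul_comp, germ_comp_ofElem, ht, simpleGen_ofElem,
        simpleGen_ofElem, triangleGen_lam, mul_inv_cancel]
    · change simpleGen lam T (Simple.mul lam T _ _) = _
      rw [e, simpleGen_ofElem, simpleGen_ofElem, simpleGen_ofElem, triangleGen_mul h1.1]

/-- The action of `Γ_𝒯` on the classes of greedy infinite words. -/
noncomputable def action :
    TriangleGroup lam T →* Equiv.Perm (GarsideGerm.GreedySeq.Class (germ hT hG)) :=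
  PresentedGroup.toGroup
    (f := fun x => GarsideGerm.GreedySeq.Class.perm (M := germ hT hG) (ofElem x)) <| by
    have h1 : ∀ x : G.Elem, GarsideGerm.GreedySeq.Class.perm (M := germ hT hG) (ofElem (lam x)) *
        GarsideGerm.GreedySeq.Class.perm (ofElem x) = 1 := by
      intro x
      have hx := germ_comp_ofElem hT hG (lam x)
      rw [hT.involutive] at hx
      rw [← hx, ← GarsideGerm.GreedySeq.Class.perm_mul le_rfl, (germ hT hG).mul_comp,
        GarsideGerm.GreedySeq.Class.perm_top]
    rintro r (⟨v, rfl⟩ | ⟨u, v, w, h, rfl⟩)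
    · simpa using h1 v
    · simp only [map_mul, FreeGroup.lift_apply_of]
      refine prod_eq_one_of_mem hT (f := fun x =>
        GarsideGerm.GreedySeq.Class.perm (M := germ hT hG) (ofElem x)) h1 ?_ h
      intro u v w h
      have hle : ofElem v ≤ (germ hT hG).comp (ofElem u) := by
        rw [germ_comp_ofElem hT hG]
        exact (Big.lt hT hG h).le
      rw [← GarsideGerm.GreedySeq.Class.perm_mul hle]
      exact congrArg _ (mul_ofElem hT h.1)

theorem action_wordEval (w : List G.Elem) :
    action hT hG (wordEval (triangleGen lam T) w) =
      ((w.map ofElem).map (GarsideGerm.GreedySeq.Class.perm (M := germ hT hG))).prod := by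
  rw [wordEval, map_list_prod, List.map_map, List.map_map]
  congr 2

theorem eq_of_wordEval_eq {v w : List G.Elem} (hv : v ∈ normalForms lam)
    (hw : w ∈ normalForms lam)
    (h : wordEval (triangleGen lam T) v = wordEval (triangleGen lam T) w) : v = w := by
  have := nonempty_of_hasDimension hG
  have hv' := (isNormal_map_ofElem hT hG).2 hv
  have hw' := (isNormal_map_ofElem hT hG).2 hw
  refine List.map_injective_iff.2 ofElem_injective (GarsideGerm.eq_of_prod_perm_eq hv'.chain
    hw'.chain hv'.bot_notMem hw'.bot_notMem hv'.top_notMem hw'.top_notMem ?_)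
  rw [← action_wordEval, ← action_wordEval, h]

/-! ### Normal forms, geodesics and automaticity -/

theorem exists_mul_right {u : List G.Elem} (hu : u ∈ normalForms lam) (x : G.Elem) :
    ∃ v ∈ normalForms lam, v.length ≤ u.length + 1 ∧
      wordEval (triangleGen lam T) v = wordEval (triangleGen lam T) u * triangleGen lam T x ∧
      ∀ t, ∃ y, wordAt (triangleGen lam T) v t =
        wordAt (triangleGen lam T) u t * simpleGen lam T y := by
  obtain ⟨v, h1, h2, h3, h4⟩ := (isRep_simpleGen hT hG).exists_isNormal_mul_right
    ((isNormal_map_ofElem hT hG).2 hu) (ofElem x)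
  obtain ⟨v, hv, rfl⟩ := exists_map_ofElem hT hG h1
  simp only [wordEval_map_ofElem, wordAt_map_ofElem, simpleGen_ofElem, List.length_map]
    at h2 h3 h4
  exact ⟨v, hv, h2, h3, h4⟩

theorem exists_mul_left {u : List G.Elem} (hu : u ∈ normalForms lam) (x : G.Elem) :
    ∃ v ∈ normalForms lam,
      wordEval (triangleGen lam T) v = triangleGen lam T x * wordEval (triangleGen lam T) u ∧
      ∀ t, ∃ y, wordAt (triangleGen lam T) v t =
        triangleGen lam T x * wordAt (triangleGen lam T) u t * simpleGen lam T y := by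
  obtain ⟨v, h1, h3, h4⟩ := (isRep_simpleGen hT hG).exists_isNormal_mul_left
    ((isNormal_map_ofElem hT hG).2 hu) (ofElem x)
  obtain ⟨v, hv, rfl⟩ := exists_map_ofElem hT hG h1
  simp only [wordEval_map_ofElem, wordAt_map_ofElem, simpleGen_ofElem] at h3 h4
  exact ⟨v, hv, h3, h4⟩

omit hT hG in
theorem nil_mem_normalForms : ([] : List G.Elem) ∈ normalForms lam := List.isChain_nil

/-- Normalizing letter by letter adds at most one to the length each time; with uniqueness, this
bound makes normal forms geodesic. -/
theorem exists_normalForm_wordEval (w : List G.Elem) :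
    ∃ v ∈ normalForms lam, v.length ≤ w.length ∧
      wordEval (triangleGen lam T) v = wordEval (triangleGen lam T) w := by
  induction w using List.reverseRecOn with
  | nil => exact ⟨[], nil_mem_normalForms, le_rfl, rfl⟩
  | append_singleton w x ih =>
    obtain ⟨u, h1, h2, h3⟩ := ih
    obtain ⟨v, h4, h5, h6, -⟩ := exists_mul_right hT hG h1 x
    refine ⟨v, h4, ?_, ?_⟩
    · rw [List.length_append, List.length_singleton]
      omega
    · rw [h6, h3, wordEval_append, wordEval_cons, wordEval_nil, mul_one]

omit hT hG in
theorem exists_wordEval (g : TriangleGroup lam T) :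
    ∃ w : List G.Elem, wordEval (triangleGen lam T) w = g := by
  induction g using PresentedGroup.induction_on with
  | _ z =>
  induction z using FreeGroup.induction_on with
  | C1 => exact ⟨[], rfl⟩
  | of x => exact ⟨[x], by rw [wordEval_cons, wordEval_nil, mul_one]; rfl⟩
  | inv_of x _ =>
    refine ⟨[lam x], ?_⟩
    rw [wordEval_cons, wordEval_nil, mul_one, triangleGen_lam]
    rfl
  | mul x y hx hy =>
    obtain ⟨v, hv⟩ := hx
    obtain ⟨w, hw⟩ := hy
    refine ⟨v ++ w, ?_⟩
    rw [wordEval_append, hv, hw]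
    rfl

theorem existsUnique_normalForm (g : TriangleGroup lam T) :
    ∃! v : List G.Elem, v ∈ normalForms lam ∧ wordEval (triangleGen lam T) v = g := by
  obtain ⟨w, rfl⟩ := exists_wordEval g
  obtain ⟨v, h1, -, h2⟩ := exists_normalForm_wordEval hT hG w
  exact ⟨v, ⟨h1, h2⟩, fun v' hv' => eq_of_wordEval_eq hT hG hv'.1 h1 (hv'.2.trans h2.symm)⟩

theorem wordLength_wordEval {u : List G.Elem} (hu : u ∈ normalForms lam) :
    wordLength (triangleGen lam T) (wordEval (triangleGen lam T) u) = u.length := by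
  apply le_antisymm
  · exact Nat.sInf_le ⟨u, rfl, rfl⟩
  · refine le_csInf ⟨_, u, rfl, rfl⟩ ?_
    rintro _ ⟨w, hw, rfl⟩
    obtain ⟨v, h1, h2, h3⟩ := exists_normalForm_wordEval hT hG w
    rwa [eq_of_wordEval_eq hT hG h1 hu (h3.trans hw)] at h2

omit hT hG in
theorem wordLength_simpleGen_le (s : Simple G) :
    wordLength (triangleGen lam T) (simpleGen lam T s) ≤ 1 := by
  rcases simpleGen_mem (lam := lam) (T := T) s with h | ⟨x, h⟩
  · rw [h]
    have h0 : wordLength (triangleGen lam T) 1 ≤ 0 := Nat.sInf_le ⟨[], rfl, rfl⟩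
    exact h0.trans zero_le_one
  · rw [h]
    exact Nat.sInf_le ⟨[x], by rw [wordEval_cons, wordEval_nil, mul_one], rfl⟩

theorem fellow_travel {u : List G.Elem} (hu : u ∈ normalForms lam) (x : G.Elem)
    {v : List G.Elem} (hv : v ∈ normalForms lam)
    (h : wordEval (triangleGen lam T) v = wordEval (triangleGen lam T) u * triangleGen lam T x)
    (t : ℕ) :
    ∃ y, wordAt (triangleGen lam T) v t = wordAt (triangleGen lam T) u t * simpleGen lam T y := by
  obtain ⟨v', h1, -, h2, h3⟩ := exists_mul_right hT hG hu x
  rw [eq_of_wordEval_eq hT hG hv h1 (h.trans h2.symm)]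
  exact h3 t

theorem fellow_travel_left {u : List G.Elem} (hu : u ∈ normalForms lam) (x : G.Elem)
    {v : List G.Elem} (hv : v ∈ normalForms lam)
    (h : wordEval (triangleGen lam T) v = triangleGen lam T x * wordEval (triangleGen lam T) u)
    (t : ℕ) :
    ∃ y, wordAt (triangleGen lam T) v t =
      triangleGen lam T x * wordAt (triangleGen lam T) u t * simpleGen lam T y := by
  obtain ⟨v', h1, h2, h3⟩ := exists_mul_left hT hG hu x
  rw [eq_of_wordEval_eq hT hG hv h1 (h.trans h2.symm)]
  exact h3 t

omit hG in
theorem isSymmetricLanguage :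
    IsSymmetricLanguage (triangleGen lam T) lam (normalForms lam) where
  involutive := hT.involutive
  map_inv := triangleGen_lam
  inv_mem w hw := by
    change List.IsChain _ _
    rw [List.isChain_reverse, List.isChain_map]
    refine List.IsChain.imp ?_ hw
    rintro a b h ⟨z, h1, h2⟩
    rw [hT.involutive] at h1
    exact h ⟨z, h2, h1⟩

theorem isBiautomaticStructure [Finite P] :
    IsBiautomaticStructure (triangleGen lam T) (normalForms lam) := by
  have hA : Finite G.Elem :=
    Finite.of_injective (fun x : G.Elem => x.1.1) fun _ _ h => Subtype.ext (Subtype.ext h)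
  have hL : (normalForms lam).IsRegular := Language.isRegular_isChain _
  -- All discrepancies between fellow travelling prefixes are `1` or a generator, a finite set.
  have hF : (insert 1 (Set.range (triangleGen lam T))).Finite := (Set.finite_range _).insert 1
  have hmem : ∀ s, simpleGen lam T s ∈ insert 1 (Set.range (triangleGen lam T)) := by
    intro s
    rcases simpleGen_mem (lam := lam) (T := T) s with h | ⟨x, h⟩
    · exact Or.inl h
    · exact Or.inr ⟨x, h.symm⟩
  refine { finite := hA, regular := hL, surjective := fun g => ?_, regular_eq := ?_,
           regular_mul_right := fun a => ?_, regular_mul_left := fun a => ?_ }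
  · obtain ⟨v, hv, -⟩ := existsUnique_normalForm hT hG g
    exact ⟨v, hv.1, hv.2⟩
  · refine isRegular_multiplierLanguage hL hF fun w₁ h₁ w₂ h₂ e t => ?_
    rw [one_mul, mul_one] at e
    rw [eq_of_wordEval_eq hT hG h₁ h₂ e, one_mul, inv_mul_cancel]
    exact Or.inl rfl
  · refine isRegular_multiplierLanguage hL hF fun w₁ h₁ w₂ h₂ e t => ?_
    rw [one_mul] at e
    obtain ⟨y, hy⟩ := fellow_travel hT hG h₁ a h₂ e.symm t
    rw [hy, one_mul, inv_mul_cancel_left]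
    exact hmem y
  · refine isRegular_multiplierLanguage hL hF fun w₁ h₁ w₂ h₂ e t => ?_
    rw [mul_one] at e
    obtain ⟨y, hy⟩ := fellow_travel_left hT hG h₁ a h₂ e.symm t
    rw [hy, inv_mul_cancel_left]
    exact hmem y

end IsTrianglePresentation

theorem theorem2 {P : Type u} [Finite P] (G : ProjGeometry P) (n : ℕ) (hn : 2 ≤ n)
    (hG : G.HasDimension n) (lam : G.Elem → G.Elem) (T : Set (G.Elem × G.Elem × G.Elem))
    (hT : IsTrianglePresentation G n lam T) :
    -- every element of the group has a unique normal form
    (∀ g : TriangleGroup lam T,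
      ∃! v : List G.Elem, v ∈ normalForms lam ∧ wordEval (triangleGen lam T) v = g) ∧
    -- the fellow traveller property
    (∀ u ∈ normalForms lam, ∀ x : G.Elem, ∀ v ∈ normalForms lam,
      wordEval (triangleGen lam T) v = wordEval (triangleGen lam T) u * triangleGen lam T x →
      ∀ t : ℕ,
        wordDist (triangleGen lam T) (wordAt (triangleGen lam T) u t)
          (wordAt (triangleGen lam T) v t) ≤ 1 ∧
        (wordAt (triangleGen lam T) u t = wordAt (triangleGen lam T) v t ∨
          ∃ y : G.Elem, wordAt (triangleGen lam T) u t =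
            wordAt (triangleGen lam T) v t * triangleGen lam T y)) ∧
    -- the language of normal forms is regular, geodesic and symmetric
    (normalForms lam).IsRegular ∧
    (∀ u ∈ normalForms lam,
      wordLength (triangleGen lam T) (wordEval (triangleGen lam T) u) = u.length) ∧
    IsSymmetricLanguage (triangleGen lam T) lam (normalForms lam) ∧
    -- it is the language of an automatic, and indeed of a biautomatic, structure
    IsAutomaticStructure (triangleGen lam T) (normalForms lam) ∧
    IsBiautomaticStructure (triangleGen lam T) (normalForms lam) ∧
    IsAutomaticGroup (TriangleGroup lam T) ∧
    IsBiautomaticGroup (TriangleGroup lam T) ∧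
    IsSymmetricAutomaticGroup (TriangleGroup lam T) := by

  have hB := IsTrianglePresentation.isBiautomaticStructure hT hG
  have hS := IsTrianglePresentation.isSymmetricLanguage hT
  refine ⟨IsTrianglePresentation.existsUnique_normalForm hT hG, ?_, hB.regular,
    fun u hu => IsTrianglePresentation.wordLength_wordEval hT hG hu, hS,
    hB.toIsAutomaticStructure, hB, ⟨_, _, _, hB.toIsAutomaticStructure⟩, ⟨_, _, _, hB⟩,
    ⟨_, _, _, _, hB.toIsAutomaticStructure, hS⟩⟩
  intro u hu x v hv h t
  obtain ⟨y, hy⟩ := IsTrianglePresentation.fellow_travel hT hG hu x hv h t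
  constructor
  · rw [wordDist, hy, inv_mul_cancel_left]
    exact IsTrianglePresentation.wordLength_simpleGen_le y
  · rcases IsTrianglePresentation.simpleGen_mem (lam := lam) (T := T) y with hs | ⟨z, hz⟩
    · left
      rw [hy, hs, mul_one]
    · right
      -- The discrepancy is sought from `v` back to `u`, hence the inverse generator.
      refine ⟨lam z, ?_⟩
      rw [hy, hz, IsTrianglePresentation.triangleGen_lam, mul_inv_cancel_right]
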